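/- Let $\Bbbk$ be an algebraically closed field of characteristic zero and let $\mathfrak{g} = \mathrm{sl}(2) \otimes_{\Bbbk} \Bbbk[t^{\pm 1}]$ be the loop algebra of $\mathrm{sl}(2) = \mathrm{span}_{\Bbbk}\{e, f, h\}$, with bracket $[x(i), y(j)] = [x,y](i+j)$, where $x(j) = x \otimes t^j$; it is $\mathbb{Z}$-graded by $\deg x(j) = j$. Let $\bar{M}(0) = \mathrm{Ind}_{\mathcal{H} \oplus \mathcal{E}}^{\mathfrak{g}} \Bbbk v$ be the $\mathfrak{g}$-module induced from the one-dimensional trivial module $\Bbbk v$ of the subalgebra $\mathcal{H} \oplus \mathcal{E}$, where $\mathcal{H} = \bigoplus_{j \in \mathbb{Z}} \Bbbk h(j)$ and $\mathcal{E} = \bigoplus_{j \in \mathbb{Z}} \Bbbk e(j)$, graded so that $\deg v = 0$. All modules are $\mathbb{Z}$-graded compatibly with $\mathfrak{g}$: submodules are graded submodules, a module is irreducible if it is non-zero and has no graded submodules other than zero and itself, and isomorphisms are homogeneous (of any degree). Let $Q = \bigoplus_{j \in \mathbb{Z}} Q^{(j)}$ be an irreducible subquotient of $\bar{M}(0)$,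 that is, an irreducible graded $\mathfrak{g}$-module isomorphic to $N/P$ for some graded submodules $P \subset N$ of $\bar{M}(0)$. Then every component of $Q$ has finite dimension: for every $\lambda \in \Bbbk$ and every $j \in \mathbb{Z}$ the space $$ \{\, q \in Q^{(j)} \mid h(0)\, q = -2 \lambda\, q \,\} $$ is finite-dimensional over $\Bbbk$. -/

import Mathlib

noncomputable section

open scoped TensorProduct

namespace ImaginaryVerma

section Induced

attribute [local instance 100] LieRing.ofAssociativeRing

variable (R L W : Type*) [CommRing R] [LieRing L] [LieAlgebra R L] (B : LieSubalgebra R L)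
  [AddCommGroup W] [Module R W] [LieRingModule B W]

/-- The `U(L)`-submodule of `U(L) ⊗[R] W` by which one divides in order to obtain the tensor
product over `U(B)`: it is generated by the elements `b ⊗ w - 1 ⊗ b w` with `b` in `B`. -/
def inducedRelations : Submodule (UniversalEnvelopingAlgebra R L)
    (UniversalEnvelopingAlgebra R L ⊗[R] W) :=
  Submodule.span (UniversalEnvelopingAlgebra R L)
    {z | ∃ (b : B) (w : W),
      z = UniversalEnvelopingAlgebra.ι R (b : L) ⊗ₜ[R] w
        - (1 : UniversalEnvelopingAlgebra R L) ⊗ₜ[R] ⁅b, w⁆}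

/-- The induced module `Ind_B^L W = U(L) ⊗_{U(B)} W`. -/
def Induced : Type _ :=
  (UniversalEnvelopingAlgebra R L ⊗[R] W) ⧸ inducedRelations R L W B

instance : AddCommGroup (Induced R L W B) :=
  inferInstanceAs (AddCommGroup ((_ ⊗[R] W) ⧸ inducedRelations R L W B))

instance : Module (UniversalEnvelopingAlgebra R L) (Induced R L W B) :=
  inferInstanceAs (Module _ ((_ ⊗[R] W) ⧸ inducedRelations R L W B))

instance : Module R (Induced R L W B) :=
  inferInstanceAs (Module R ((_ ⊗[R] W) ⧸ inducedRelations R L W B))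

instance : IsScalarTower R (UniversalEnvelopingAlgebra R L) (Induced R L W B) :=
  inferInstanceAs (IsScalarTower R _ ((_ ⊗[R] W) ⧸ inducedRelations R L W B))

/-- The Lie algebra `L` acts on the induced module through `L → U(L)`. -/
instance : LieRingModule L (Induced R L W B) where
  bracket x m := UniversalEnvelopingAlgebra.ι R x • m
  add_lie x y m := by
    change UniversalEnvelopingAlgebra.ι R (x + y) • m = _
    rw [map_add, add_smul]
  lie_add x m n := smul_add _ _ _
  leibniz_lie x y m := by
    change UniversalEnvelopingAlgebra.ι R x • UniversalEnvelopingAlgebra.ι R y • m =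
      UniversalEnvelopingAlgebra.ι R ⁅x, y⁆ • m +
        UniversalEnvelopingAlgebra.ι R y • UniversalEnvelopingAlgebra.ι R x • m
    rw [LieHom.map_lie, LieRing.of_associative_ring_bracket, sub_smul, mul_smul, mul_smul,
      sub_add_cancel]

instance : LieModule R L (Induced R L W B) where
  smul_lie r x m := by
    change UniversalEnvelopingAlgebra.ι R (r • x) • m = r • UniversalEnvelopingAlgebra.ι R x • m
    rw [map_smul, smul_assoc]
  lie_smul r x m := smul_algebra_smul_comm r (UniversalEnvelopingAlgebra.ι R x) m

end Induced

section LoopAlgebra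

variable (k : Type*) [Field k]

/-- The Lie algebra `sl(2)` of traceless `2 × 2` matrices. -/
abbrev Sl2 : Type _ := LieAlgebra.SpecialLinear.sl (Fin 2) k

/-- The loop algebra `k[t, t⁻¹] ⊗ sl(2)`. -/
abbrev Loop : Type _ := LieAlgebra.loopAlgebra k ℤ (Sl2 k)

variable {k} in
/-- The element `x(j) = t ^ j ⊗ x` of the loop algebra. -/
def loop (x : Sl2 k) (j : ℤ) : Loop k := AddMonoidAlgebra.single j (1 : k) ⊗ₜ[k] x

/-- The standard basis element `e` of `sl(2)`. -/
def e : Sl2 k := LieAlgebra.SpecialLinear.single 0 1 (by decide) 1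

/-- The standard basis element `h` of `sl(2)`. -/
def h : Sl2 k := LieAlgebra.SpecialLinear.singleSubSingle 0 1 1

lemma lie_h_e : ⁅h k, e k⁆ = (2 : k) • e k := by
  apply Subtype.ext
  rw [LieAlgebra.SpecialLinear.sl_bracket]
  ext i j
  fin_cases i <;> fin_cases j <;>
    simp [e, h, sub_mul, mul_sub, Matrix.single_mul_single_same, one_add_one_eq_two]

variable {k} in
lemma lie_loop (x y : Sl2 k) (i j : ℤ) : ⁅loop x i, loop y j⁆ = loop ⁅x, y⁆ (i + j) := by
  rw [loop, loop, loop, LieAlgebra.ExtendScalars.bracket_tmul, AddMonoidAlgebra.single_mul_single,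
    one_mul]

/-- The subalgebra of the loop algebra spanned by all `h(j)` and all `e(j)`, `j ∈ ℤ`. -/
def borel : LieSubalgebra k (Loop k) where
  __ := Submodule.span k (Set.range (loop (h k)) ∪ Set.range (loop (e k)))
  lie_mem' {x y} hx hy := by
    simp only [AddSubsemigroup.mem_carrier, AddSubmonoid.mem_toSubsemigroup,
      Submodule.mem_toAddSubmonoid] at hx hy ⊢
    have key : ∀ (i : ℤ), loop (e k) i ∈
        Submodule.span k (Set.range (loop (h k)) ∪ Set.range (loop (e k))) :=
      fun i => Submodule.subset_span (Or.inr ⟨i, rfl⟩)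
    have hs : ∀ (c : k) (x : Sl2 k) (i : ℤ), loop (c • x) i = c • loop x i := by
      intro c x i; simp [loop]
    have h0 : ∀ i : ℤ, loop (0 : Sl2 k) i = 0 := by intro i; simp [loop]
    induction hx using Submodule.span_induction with
    | zero => simp
    | add u v _ _ hu hv => rw [add_lie]; exact add_mem hu hv
    | smul c u _ hu => rw [smul_lie]; exact Submodule.smul_mem _ _ hu
    | mem u hu =>
      induction hy using Submodule.span_induction with
      | zero => simp
      | add a b _ _ ha hb => rw [lie_add]; exact add_mem ha hb
      | smul c a _ ha => rw [lie_smul]; exact Submodule.smul_mem _ _ ha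
      | mem v hv =>
        rcases hu with ⟨i, rfl⟩ | ⟨i, rfl⟩ <;> rcases hv with ⟨j, rfl⟩ | ⟨j, rfl⟩
        · rw [lie_loop, lie_self, h0]; exact zero_mem _
        · rw [lie_loop, lie_h_e, hs]; exact Submodule.smul_mem _ _ (key _)
        · rw [lie_loop, ← lie_skew, lie_h_e, ← neg_smul, hs]
          exact Submodule.smul_mem _ _ (key _)
        · rw [lie_loop, lie_self, h0]; exact zero_mem _

/-- The module `M̄(0)`: the module induced to the loop algebra from the trivial one-dimensional
module of `borel k`. -/
abbrev MBar : Type _ := Induced k (Loop k) (TrivialLieModule k (borel k) k) (borel k)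

/-- The generator `1 ⊗ 1` of `M̄(0)`. -/
def gen : MBar k :=
  Submodule.Quotient.mk ((1 : UniversalEnvelopingAlgebra k (Loop k)) ⊗ₜ[k]
    (TrivialLieModule.equiv k (borel k) k).symm 1)

/-- The degree `d` component of `M̄(0)`, where the generator has degree zero and `x(j)` raises the
degree by `j`: the span of all `x₁(j₁) ⋯ xₙ(jₙ) · gen` with `j₁ + ⋯ + jₙ = d`. -/
def degMBar (d : ℤ) : Submodule k (MBar k) :=
  Submodule.span k {m | ∃ l : List (Sl2 k × ℤ), (l.map Prod.snd).sum = d ∧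
    m = l.foldr (fun p m => ⁅loop p.1 p.2, m⁆) (gen k)}

end LoopAlgebra

section Graded

variable {k : Type*} [Field k] {V : Type*} [AddCommGroup V] [Module k V]
  [LieRingModule (Loop k) V]

/-- The family `𝒱` is a grading of the `Loop k`-module `V`, compatible with the grading of the loop
algebra by degree in `t`. -/
structure IsGrading (𝒱 : ℤ → Submodule k V) : Prop where
  isInternal : DirectSum.IsInternal 𝒱
  lie_mem : ∀ (x : Sl2 k) (i j : ℤ) (v : V), v ∈ 𝒱 j → ⁅loop x i, v⁆ ∈ 𝒱 (i + j)

/-- A submodule is graded if it is the sum of its homogeneous components. -/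
def IsGradedSubmodule (𝒱 : ℤ → Submodule k V) (N : LieSubmodule k (Loop k) V) : Prop :=
  N.toSubmodule = ⨆ j : ℤ, N.toSubmodule ⊓ 𝒱 j

/-- Irreducibility of graded modules: `V` is non-zero and its only graded submodules are `0` and
`V`. -/
def IsGradedIrreducible (𝒱 : ℤ → Submodule k V) : Prop :=
  Nontrivial V ∧ ∀ N : LieSubmodule k (Loop k) V, IsGradedSubmodule 𝒱 N → N = ⊥ ∨ N = ⊤

variable [LieModule k (Loop k) V]

/-- The layer of index `a`: the eigenspace of `h(0)` for the eigenvalue `-2 a`. -/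
def layer (V : Type*) [AddCommGroup V] [Module k V] [LieRingModule (Loop k) V]
    [LieModule k (Loop k) V] (a : k) : Submodule k V :=
  (LieModule.toEnd k (Loop k) V (loop (h k) 0)).eigenspace (-2 * a)

/-- The component of layer index `a` and degree `j`. -/
def component (𝒱 : ℤ → Submodule k V) (a : k) (j : ℤ) : Submodule k V := layer V a ⊓ 𝒱 j

/-- The graded module `(Q, 𝒬)` is a subquotient of the graded module `(V, 𝒱)`: there are graded
submodules `P ⊆ N` of `V` and an isomorphism of `Q` onto `N / P`, homogeneous of some degree `s`. -/
def IsSubquotient (𝒱 : ℤ → Submodule k V) {Q : Type*} [AddCommGroup Q] [Module k Q]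
    [LieRingModule (Loop k) Q] [LieModule k (Loop k) Q] (𝒬 : ℤ → Submodule k Q) : Prop :=
  ∃ N P : LieSubmodule k (Loop k) V, IsGradedSubmodule 𝒱 N ∧ IsGradedSubmodule 𝒱 P ∧ P ≤ N ∧
    ∃ (φ : Q ≃ₗ⁅k, Loop k⁆ (N ⧸ P.comap N.incl)) (s : ℤ), ∀ (j : ℤ), ∀ q ∈ 𝒬 j,
      ∃ n : N, (n : V) ∈ 𝒱 (j + s) ∧ φ q = LieSubmodule.Quotient.mk n

end Graded

end ImaginaryVerma

end

/-! The layer of index `n` of `M̄(0)` is the image of the Laurent polynomials in `n` variables under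
`laurentMap`, with monomials going to words in the `f(i)`. On it `h(j)` acts as multiplication by
`-2` times the power sum of exponent `j` (`laurentMap_powerSum_mul`). Hence each layer of `Q` is the
image of a module over the algebra `S` generated by the power sums. These satisfy the linear
recurrence whose coefficients are, up to sign, the elementary symmetric functions; the last of these
is invertible in `S`, so the recurrence runs in both directions (`exists_hasRecurrence`) and `S` is
finitely generated.

Take the lowest nonzero layer of `Q`. All `e(j)` kill it, so irreducibility makes every nonzero
homogeneous vector in it a generator over `S`. Fix such a vector `q` and a maximal ideal `M` of `S`
containing its annihilator. A homogeneous element `s` of `M` kills `q`: otherwise `t s q = q` for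
some `t`, so `t s - 1` lies in `M`, and so does `1`. Each degree component of the layer is therefore
bounded by `S / M`, which is finite over `k` by the Nullstellensatz
(`finiteDimensional_lowest_component`).

The recurrence then passes from the `h(j)` to the `f(j)`: the corresponding combination of the
`f(j)` applied to the lowest layer is killed by all `e(l)`, and such a homogeneous vector one layer
up must vanish, since it would generate a submodule missing the lowest layer. So `f(0), …, f(n - 1)`
suffice on the lowest layer, and on every higher layer because the `f(j)` commute. A component of
one layer is thus a sum of `n` images of components of the layer before it, and induction finishes
(`finiteDimensional_layer_inf`). -/

noncomputable section

open scoped TensorProduct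

namespace ImaginaryVerma

/-! ### Independent families and invariant subspaces of diagonalizable operators. -/

section LatticeAndEigenspaces

/-- A family of pieces of an independent family meets each member only in its own piece. -/
lemma inf_iSup_le_of_iSupIndep {ι R V : Type*} [Ring R] [AddCommGroup V] [Module R V]
    {E A : ι → Submodule R V} (hE : iSupIndep E) (hA : ∀ i, A i ≤ E i) (i : ι) :
    E i ⊓ ⨆ j, A j ≤ A i := by
  have hsup : ⨆ j, A j ≤ A i ⊔ ⨆ (j) (_ : j ≠ i), E j := by
    refine iSup_le fun j => ?_
    by_cases hj : j = i
    · subst hj; exact le_sup_left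
    · exact ((hA j).trans (le_iSup₂_of_le j hj le_rfl)).trans le_sup_right
  calc E i ⊓ ⨆ j, A j ≤ (A i ⊔ ⨆ (j) (_ : j ≠ i), E j) ⊓ E i := by
        rw [inf_comm]; exact inf_le_inf_right _ hsup
    _ = A i ⊔ (⨆ (j) (_ : j ≠ i), E j) ⊓ E i := (sup_inf_assoc_of_le _ (hA i)).symm ▸ rfl
    _ = A i := by rw [inf_comm, (hE i).eq_bot, sup_bot_eq]

variable {k V : Type*} [Field k] [AddCommGroup V] [Module k V]

/-- Applying `T - ν` to the sum removes the `ν`-term and rescales each other term by the nonzero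
scalar `μ - ν`, which allows induction on the number of terms. -/
lemma mem_of_sum_eigenvectors_mem {T : Module.End k V} {N : Submodule k V}
    (hN : ∀ x ∈ N, T x ∈ N) (s : Finset k) (x : k → V)
    (hx : ∀ μ ∈ s, x μ ∈ T.eigenspace μ) (hs : ∑ μ ∈ s, x μ ∈ N) : ∀ μ ∈ s, x μ ∈ N := by
  classical
  induction s using Finset.induction_on generalizing x with
  | empty => simp
  | insert ν s hν ih =>
    have h1 : ∑ μ ∈ s, (μ - ν) • x μ ∈ N := by
      have : ∑ μ ∈ s, (μ - ν) • x μ =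
          T (∑ μ ∈ insert ν s, x μ) - ν • ∑ μ ∈ insert ν s, x μ := by
        rw [map_sum, Finset.smul_sum, ← Finset.sum_sub_distrib, Finset.sum_insert hν,
          Module.End.mem_eigenspace_iff.1 (hx ν (Finset.mem_insert_self _ _)), sub_self, zero_add]
        refine Finset.sum_congr rfl fun μ hμ => ?_
        rw [Module.End.mem_eigenspace_iff.1 (hx μ (Finset.mem_insert_of_mem hμ)), sub_smul]
      rw [this]
      exact N.sub_mem (hN _ hs) (N.smul_mem _ hs)
    have h2 : ∀ μ ∈ s, x μ ∈ N := fun μ hμ => by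
      have h3 := ih (fun μ => (μ - ν) • x μ)
        (fun μ hμ => Submodule.smul_mem _ _ (hx μ (Finset.mem_insert_of_mem hμ))) h1 μ hμ
      have hne : μ - ν ≠ 0 := sub_ne_zero.2 fun hh => hν (hh ▸ hμ)
      exact (N.smul_mem_iff hne).1 h3
    intro μ hμ
    rcases Finset.mem_insert.1 hμ with rfl | hμ
    · rw [Finset.sum_insert hν] at hs
      exact (N.add_mem_iff_left (N.sum_mem h2)).1 hs
    · exact h2 μ hμ

/-- An invariant subspace of a diagonalizable operator is the sum of its eigenspaces. -/
lemma le_iSup_inf_eigenspace {T : Module.End k V} {N : Submodule k V}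
    (hN : ∀ x ∈ N, T x ∈ N) (hT : ⨆ μ, T.eigenspace μ = ⊤) :
    N ≤ ⨆ μ, N ⊓ T.eigenspace μ := by
  classical
  intro x hx
  obtain ⟨y, hy, rfl⟩ := (Submodule.mem_iSup_iff_exists_finsupp _ _).1
    (hT ▸ Submodule.mem_top : x ∈ ⨆ μ, T.eigenspace μ)
  refine Submodule.sum_mem _ fun μ hμ => Submodule.mem_iSup_of_mem μ ⟨?_, hy μ⟩
  exact mem_of_sum_eigenvectors_mem hN y.support y (fun μ _ => hy μ) hx μ hμ

end LatticeAndEigenspaces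

/-! ### Commutation relations in the loop algebra. -/

section Sl2

variable (k : Type*) [Field k]

/-- The standard basis element `f` of `sl(2)`. -/
def f : Sl2 k := LieAlgebra.SpecialLinear.single 1 0 (by decide) 1

lemma lie_h_f : ⁅h k, f k⁆ = (-2 : k) • f k := by
  apply Subtype.ext
  rw [LieAlgebra.SpecialLinear.sl_bracket]
  ext i j
  fin_cases i <;> fin_cases j <;>
    simp [f, h, sub_mul, mul_sub, Matrix.single_mul_single_same]
  ring

lemma lie_e_f : ⁅e k, f k⁆ = h k := by
  apply Subtype.ext
  rw [LieAlgebra.SpecialLinear.sl_bracket]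
  ext i j
  fin_cases i <;> fin_cases j <;> simp [e, f, h, Matrix.single_mul_single_same]

variable {k}

lemma sl2_eq_sum (x : Sl2 k) :
    x = x.val 0 1 • e k + x.val 1 0 • f k + x.val 0 0 • h k := by
  have htr : x.val 0 0 + x.val 1 1 = 0 := by
    have htr : Matrix.trace x.val = 0 := x.2
    rwa [Matrix.trace_fin_two] at htr
  apply Subtype.ext
  ext i j
  fin_cases i <;> fin_cases j <;> simp [e, f, h]
  exact eq_neg_of_add_eq_zero_right htr

lemma loop_add (x y : Sl2 k) (j : ℤ) : loop (x + y) j = loop x j + loop y j := by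
  simp [loop, TensorProduct.tmul_add]

lemma loop_smul (c : k) (x : Sl2 k) (j : ℤ) : loop (c • x) j = c • loop x j := by
  simp [loop]

lemma loop_zero (j : ℤ) : loop (0 : Sl2 k) j = 0 := by simp [loop]

/-- The elements `x(j)` span the loop algebra. -/
lemma loop_induction {p : Loop k → Prop} (hz : p 0) (ha : ∀ x y, p x → p y → p (x + y))
    (hs : ∀ (c : k) x, p x → p (c • x)) (hl : ∀ x j, p (loop x j)) (x : Loop k) : p x := by
  induction x using TensorProduct.induction_on with
  | zero => exact hz
  | add x y hx hy => exact ha x y hx hy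
  | tmul a x =>
    induction a using AddMonoidAlgebra.induction_linear with
    | zero => simpa using hz
    | add a b ha' hb' => rw [TensorProduct.add_tmul]; exact ha _ _ ha' hb'
    | single j c =>
      have : (AddMonoidAlgebra.single j c : AddMonoidAlgebra k ℤ) ⊗ₜ[k] x = c • loop x j := by
        rw [loop, TensorProduct.smul_tmul', AddMonoidAlgebra.smul_single, smul_eq_mul, mul_one]
      rw [this]
      exact hs _ _ (hl _ _)

lemma lie_e_lie_f {V : Type*} [AddCommGroup V] [LieRingModule (Loop k) V]
    (i j : ℤ) (v : V) : ⁅loop (e k) i, ⁅loop (f k) j, v⁆⁆ =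
    ⁅loop (h k) (i + j), v⁆ + ⁅loop (f k) j, ⁅loop (e k) i, v⁆⁆ := by
  rw [leibniz_lie, lie_loop, lie_e_f]

lemma lie_comm_of_self {V : Type*} [AddCommGroup V] [LieRingModule (Loop k) V]
    (x : Sl2 k) (i j : ℤ) (v : V) :
    ⁅loop x i, ⁅loop x j, v⁆⁆ = ⁅loop x j, ⁅loop x i, v⁆⁆ := by
  rw [leibniz_lie, lie_loop, lie_self, loop_zero, zero_lie, zero_add]

variable {V : Type*} [AddCommGroup V] [Module k V] [LieRingModule (Loop k) V]
  [LieModule k (Loop k) V]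

lemma loop_smul_lie (c : k) (x : Sl2 k) (j : ℤ) (v : V) :
    ⁅loop (c • x) j, v⁆ = c • ⁅loop x j, v⁆ := by
  rw [loop_smul]
  exact smul_lie c (loop x j) v

lemma lie_mem_of_loop_mem {Y : Submodule k V} {y : V} (hY : ∀ (x : Sl2 k) (j : ℤ), ⁅loop x j, y⁆ ∈ Y)
    (x : Loop k) : ⁅x, y⁆ ∈ Y := by
  induction x using loop_induction with
  | hz => simp
  | ha x z hx hz => rw [add_lie]; exact Y.add_mem hx hz
  | hs c x hx =>
    have : ⁅c • x, y⁆ = c • ⁅x, y⁆ := smul_lie c x y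
    rw [this]; exact Y.smul_mem _ hx
  | hl x j => exact hY x j

lemma lie_mem_of_efh {Y : Submodule k V} {y : V} (he : ∀ j, ⁅loop (e k) j, y⁆ ∈ Y)
    (hf : ∀ j, ⁅loop (f k) j, y⁆ ∈ Y) (hh : ∀ j, ⁅loop (h k) j, y⁆ ∈ Y) (x : Loop k) :
    ⁅x, y⁆ ∈ Y := by
  refine lie_mem_of_loop_mem (fun x j => ?_) x
  rw [sl2_eq_sum x]
  simp only [loop_add, loop_smul_lie, add_lie]
  exact Y.add_mem (Y.add_mem (Y.smul_mem _ (he j)) (Y.smul_mem _ (hf j))) (Y.smul_mem _ (hh j))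

lemma lie_h_lie_f (i j : ℤ) (v : V) : ⁅loop (h k) i, ⁅loop (f k) j, v⁆⁆ =
    (-2 : k) • ⁅loop (f k) (i + j), v⁆ + ⁅loop (f k) j, ⁅loop (h k) i, v⁆⁆ := by
  rw [leibniz_lie, lie_loop, lie_h_f, loop_smul_lie]

lemma lie_h_lie_e (i j : ℤ) (v : V) : ⁅loop (h k) i, ⁅loop (e k) j, v⁆⁆ =
    (2 : k) • ⁅loop (e k) (i + j), v⁆ + ⁅loop (e k) j, ⁅loop (h k) i, v⁆⁆ := by
  rw [leibniz_lie, lie_loop, lie_h_e, loop_smul_lie]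

end Sl2

/-! ### Layers and the stages of words in the `f(j)`. -/

section Layers

variable {k : Type*} [Field k] {V : Type*} [AddCommGroup V] [Module k V]
  [LieRingModule (Loop k) V] [LieModule k (Loop k) V]

lemma mem_layer {a : k} {v : V} : v ∈ layer V a ↔ ⁅loop (h k) 0, v⁆ = (-2 * a) • v := by
  rw [layer, Module.End.mem_eigenspace_iff, LieModule.toEnd_apply_apply]

lemma lie_f_mem_layer {a : k} {v : V} (hv : v ∈ layer V a) (j : ℤ) :
    ⁅loop (f k) j, v⁆ ∈ layer V (a + 1) := by
  rw [mem_layer] at hv ⊢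
  rw [lie_h_lie_f, hv, lie_smul, zero_add, ← add_smul]
  congr 1; ring

lemma lie_e_mem_layer {a : k} {v : V} (hv : v ∈ layer V a) (j : ℤ) :
    ⁅loop (e k) j, v⁆ ∈ layer V (a - 1) := by
  rw [mem_layer] at hv ⊢
  rw [lie_h_lie_e, hv, lie_smul, zero_add, ← add_smul]
  congr 1; ring

lemma lie_h_mem_layer {a : k} {v : V} (hv : v ∈ layer V a) (j : ℤ) :
    ⁅loop (h k) j, v⁆ ∈ layer V a := by
  rw [mem_layer] at hv ⊢
  rw [lie_comm_of_self, hv, lie_smul]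

variable (V) in
lemma iSupIndep_layer [CharZero k] : iSupIndep (fun a : k => layer V a) :=
  (Module.End.eigenspaces_iSupIndep _).comp (f := fun a : k => -2 * a)
    (mul_right_injective₀ (by norm_num))

/-- If subspaces `A i` of the layers `c i` span the module, then each layer is spanned by those
`A i` which it contains. -/
lemma layer_le_iSup_of_iSup_eq_top [CharZero k] {ι : Type*} {A : ι → Submodule k V} {c : ι → k}
    (hA : ∀ i, A i ≤ layer V (c i)) (htop : ⨆ i, A i = ⊤) (a : k) :
    layer V a ≤ ⨆ (i) (_ : c i = a), A i := by
  have key := inf_iSup_le_of_iSupIndep (iSupIndep_layer (k := k) V)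
    (A := fun a => ⨆ (i) (_ : c i = a), A i) (fun b => iSup₂_le fun i hi => hi ▸ hA i) a
  have : ⨆ b, ⨆ (i) (_ : c i = b), A i = ⊤ := by
    rw [eq_top_iff, ← htop]
    exact iSup_le fun i => le_iSup_of_le (c i) (le_iSup₂_of_le i rfl le_rfl)
  rwa [this, inf_top_eq] at key

/-- The span of all `f(i₁) ⋯ f(iᵣ) x` with `x` in `X`. -/
def fStage (X : Submodule k V) : ℕ → Submodule k V
  | 0 => X
  | r + 1 => ⨆ j : ℤ, (fStage X r).map (LieModule.toEnd k (Loop k) V (loop (f k) j))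

lemma lie_f_mem_fStage {X : Submodule k V} {r : ℕ} {v : V} (hv : v ∈ fStage X r) (j : ℤ) :
    ⁅loop (f k) j, v⁆ ∈ fStage X (r + 1) :=
  Submodule.mem_iSup_of_mem j ⟨v, hv, rfl⟩

lemma fStage_succ_le {X Y : Submodule k V} {r : ℕ}
    (hY : ∀ j, ∀ v ∈ fStage X r, ⁅loop (f k) j, v⁆ ∈ Y) : fStage X (r + 1) ≤ Y :=
  iSup_le fun j => Submodule.map_le_iff_le_comap.2 fun v hv => hY j v hv

lemma fStage_le_layer {X : Submodule k V} {a : k} (hX : X ≤ layer V a) (r : ℕ) :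
    fStage X r ≤ layer V (a + r) := by
  induction r with
  | zero => simpa [fStage] using hX
  | succ r ih =>
    refine fStage_succ_le fun j v hv => ?_
    rw [Nat.cast_succ, ← add_assoc]
    exact lie_f_mem_layer (ih hv) j

lemma lie_h_mem_fStage {X : Submodule k V} (hX : ∀ j, ∀ x ∈ X, ⁅loop (h k) j, x⁆ ∈ X) (r : ℕ) :
    ∀ j, ∀ v ∈ fStage X r, ⁅loop (h k) j, v⁆ ∈ fStage X r := by
  induction r with
  | zero => exact hX
  | succ r ih =>
    intro i
    suffices fStage X (r + 1) ≤
        (fStage X (r + 1)).comap (LieModule.toEnd k (Loop k) V (loop (h k) i)) from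
      fun v hv => this hv
    refine fStage_succ_le fun j v hv => ?_
    rw [Submodule.mem_comap, LieModule.toEnd_apply_apply, lie_h_lie_f]
    exact add_mem (Submodule.smul_mem _ _ (lie_f_mem_fStage hv _)) (lie_f_mem_fStage (ih i v hv) j)

/-- Moving `e(i)` to the right past an `f(j)` costs a term in `h(i + j)`, which preserves each
stage; on reaching `X` it gives zero. -/
lemma lie_e_mem_iSup_fStage {X : Submodule k V} (hX : ∀ j, ∀ x ∈ X, ⁅loop (h k) j, x⁆ ∈ X)
    (hE : ∀ j, ∀ x ∈ X, ⁅loop (e k) j, x⁆ = 0) (r : ℕ) :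
    ∀ j, ∀ v ∈ fStage X r, ⁅loop (e k) j, v⁆ ∈ ⨆ s, fStage X s := by
  induction r with
  | zero => intro j v hv; rw [hE j v hv]; exact zero_mem _
  | succ r ih =>
    intro i
    suffices fStage X (r + 1) ≤
        (⨆ s, fStage X s).comap (LieModule.toEnd k (Loop k) V (loop (e k) i)) from
      fun v hv => this hv
    refine fStage_succ_le fun j v hv => ?_
    rw [Submodule.mem_comap, LieModule.toEnd_apply_apply, lie_e_lie_f]
    refine add_mem (Submodule.mem_iSup_of_mem r (lie_h_mem_fStage hX r _ v hv)) ?_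
    suffices ⨆ s, fStage X s ≤
        (⨆ s, fStage X s).comap (LieModule.toEnd k (Loop k) V (loop (f k) j)) from
      this (ih i v hv)
    exact iSup_le fun s w hw => Submodule.mem_iSup_of_mem (s + 1) (lie_f_mem_fStage hw j)

/-- The submodule generated by a subspace `X` which is stable under all `h(j)` and annihilated by
all `e(j)`. -/
def fSpan (X : Submodule k V) (hX : ∀ j, ∀ x ∈ X, ⁅loop (h k) j, x⁆ ∈ X)
    (hE : ∀ j, ∀ x ∈ X, ⁅loop (e k) j, x⁆ = 0) : LieSubmodule k (Loop k) V where
  __ := ⨆ r, fStage X r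
  lie_mem {x m} hm := by
    suffices ⨆ s, fStage X s ≤ (⨆ s, fStage X s).comap (LieModule.toEnd k (Loop k) V x) from
      this hm
    refine iSup_le fun r v hv => ?_
    rw [Submodule.mem_comap, LieModule.toEnd_apply_apply]
    exact lie_mem_of_efh (fun j => lie_e_mem_iSup_fStage hX hE r j v hv)
      (fun j => Submodule.mem_iSup_of_mem (r + 1) (lie_f_mem_fStage hv j))
      (fun j => Submodule.mem_iSup_of_mem r (lie_h_mem_fStage hX r j v hv)) x

lemma le_fSpan {X : Submodule k V} (hX : ∀ j, ∀ x ∈ X, ⁅loop (h k) j, x⁆ ∈ X)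
    (hE : ∀ j, ∀ x ∈ X, ⁅loop (e k) j, x⁆ = 0) {x : V} (hx : x ∈ X) : x ∈ fSpan X hX hE :=
  Submodule.mem_iSup_of_mem (p := fStage X) 0 hx

/-- The `f(j)` commute, so a reduction to `f(0), …, f(n - 1)` valid on `X` propagates to all words.
-/
lemma fStage_succ_le_iSup_map {n : ℕ} {X : Submodule k V}
    (hX : ∀ j, ∀ v ∈ X, ⁅loop (f k) j, v⁆ ∈
      ⨆ i : Fin n, X.map (LieModule.toEnd k (Loop k) V (loop (f k) i))) (r : ℕ) :
    fStage X (r + 1) ≤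
      ⨆ i : Fin n, (fStage X r).map (LieModule.toEnd k (Loop k) V (loop (f k) i)) := by
  induction r with
  | zero => exact fStage_succ_le hX
  | succ r ih =>
    refine fStage_succ_le fun j => ?_
    suffices fStage X (r + 1) ≤
        (⨆ i : Fin n, (fStage X (r + 1)).map
          (LieModule.toEnd k (Loop k) V (loop (f k) i))).comap
          (LieModule.toEnd k (Loop k) V (loop (f k) j)) from fun v hv => this hv
    refine ih.trans (iSup_le fun i => ?_)
    rintro _ ⟨v, hv, rfl⟩
    refine Submodule.mem_iSup_of_mem i ⟨⁅loop (f k) j, v⁆, lie_f_mem_fStage hv j, ?_⟩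
    exact lie_comm_of_self (f k) i j v

end Layers

/-! ### Generation in graded irreducible modules. -/

section GradedIrreducible

variable {k : Type*} [Field k] {V : Type*} [AddCommGroup V] [Module k V]
  [LieRingModule (Loop k) V] [LieModule k (Loop k) V] {𝒱 : ℤ → Submodule k V}

/-- In a graded irreducible module every nonzero homogeneous vector generates everything. -/
lemma IsGradedIrreducible.eq_top_of_mem (hg : IsGrading 𝒱) (hirr : IsGradedIrreducible 𝒱)
    {d : ℤ} {v : V} (hv : v ∈ 𝒱 d) (hv0 : v ≠ 0) {N : LieSubmodule k (Loop k) V} (hN : v ∈ N) :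
    N = ⊤ := by
  -- `N` need not be graded; the sum `G` of its homogeneous parts is, and it still contains `v`.
  let G : LieSubmodule k (Loop k) V :=
    { __ := ⨆ j : ℤ, N.toSubmodule ⊓ 𝒱 j
      lie_mem {x m} hm := by
        suffices ⨆ j : ℤ, N.toSubmodule ⊓ 𝒱 j ≤
            (⨆ j : ℤ, N.toSubmodule ⊓ 𝒱 j).comap (LieModule.toEnd k (Loop k) V x) from this hm
        refine iSup_le fun j v hv => ?_
        rw [Submodule.mem_comap, LieModule.toEnd_apply_apply]
        exact lie_mem_of_loop_mem (fun y i => Submodule.mem_iSup_of_mem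
          (p := fun j : ℤ => N.toSubmodule ⊓ 𝒱 j) (i + j)
          ⟨N.lie_mem hv.1, hg.lie_mem y i j v hv.2⟩) x }
  have hGN : G.toSubmodule ≤ N.toSubmodule := iSup_le fun j => inf_le_left
  have hvG : v ∈ G := Submodule.mem_iSup_of_mem (p := fun j : ℤ => N.toSubmodule ⊓ 𝒱 j) d ⟨hN, hv⟩
  have hG : IsGradedSubmodule 𝒱 G :=
    le_antisymm (iSup_mono fun j => le_inf
      (le_iSup (fun j : ℤ => N.toSubmodule ⊓ 𝒱 j) j) inf_le_right) (iSup_le fun j => inf_le_left)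
  rcases hirr.2 G hG with h0 | h1
  · rw [h0, LieSubmodule.mem_bot] at hvG
    exact absurd hvG hv0
  · rw [eq_top_iff]
    intro x _
    exact hGN (by rw [h1]; trivial)

/-- If a subspace is stable under all `h(j)`, annihilated by all `e(j)` and
contains a nonzero homogeneous vector, then a graded irreducible module is spanned by the words in
the `f(j)` applied to it. -/
lemma IsGradedIrreducible.iSup_fStage_eq_top (hg : IsGrading 𝒱) (hirr : IsGradedIrreducible 𝒱)
    {X : Submodule k V} (hX : ∀ j, ∀ x ∈ X, ⁅loop (h k) j, x⁆ ∈ X)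
    (hE : ∀ j, ∀ x ∈ X, ⁅loop (e k) j, x⁆ = 0) {v : V} {d : ℤ} (hvX : v ∈ X) (hv : v ∈ 𝒱 d)
    (hv0 : v ≠ 0) : ⨆ r, fStage X r = ⊤ :=
  congrArg LieSubmodule.toSubmodule (hirr.eq_top_of_mem hg hv hv0 (le_fSpan hX hE hvX))

end GradedIrreducible


/-- Two-sided induction on `ℤ` from a window of length `n`. -/
lemma int_window_induction {P : ℤ → Prop} (n : ℕ) (hbase : ∀ i : ℕ, i < n → P i)
    (hup : ∀ j, (∀ i : ℕ, i < n → P (i + j)) → P (n + j))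
    (hdown : ∀ j, (∀ i : ℕ, i < n → P ((i + 1 : ℕ) + j)) → P j) (j : ℤ) : P j := by
  have hnat : ∀ j : ℕ, P j := by
    intro j
    induction j using Nat.strong_induction_on with
    | _ j ih =>
      by_cases hj : j < n
      · exact hbase j hj
      · have := hup ((j - n : ℕ) : ℤ) fun i hi => by
          have := ih (i + (j - n)) (by omega)
          exact_mod_cast this
        have h2 : (n : ℤ) + ((j - n : ℕ) : ℤ) = j := by omega
        rwa [h2] at this
  have hneg : ∀ t : ℕ, P (-(t : ℤ)) := by
    intro t
    induction t using Nat.strong_induction_on with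
    | _ t ih =>
      refine hdown _ fun i hi => ?_
      by_cases hit : t ≤ i + 1
      · have := hnat (i + 1 - t)
        have h2 : ((i + 1 - t : ℕ) : ℤ) = ((i + 1 : ℕ) : ℤ) + -(t : ℤ) := by omega
        rwa [h2] at this
      · have := ih (t - (i + 1)) (by omega)
        have h2 : -((t - (i + 1) : ℕ) : ℤ) = ((i + 1 : ℕ) : ℤ) + -(t : ℤ) := by omega
        rwa [h2] at this
  rcases le_total 0 j with hj | hj
  · lift j to ℕ using hj; exact hnat j
  · have := hneg (-j).toNat
    have h2 : -(((-j).toNat : ℕ) : ℤ) = j := by omega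
    rwa [h2] at this

/-! ### The algebra of power sums and its recurrence. -/

section PowerSums

variable {k : Type*} [Field k]

/-- The span of the monomials of degree `m` in the elements `p j`, where `p j` has degree `j`. -/
def degreeSpan {S : Type*} [CommRing S] [Algebra k S] (p : ℤ → S) (m : ℤ) : Submodule k S :=
  Submodule.span k {s | ∃ l : List ℤ, l.sum = m ∧ s = (l.map p).prod}

variable {S : Type*} [CommRing S] [Algebra k S]

lemma one_mem_degreeSpan (p : ℤ → S) : (1 : S) ∈ degreeSpan (k := k) p 0 :=
  Submodule.subset_span ⟨[], by simp, by simp⟩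

lemma mul_mem_degreeSpan {p : ℤ → S} {m : ℤ} {s : S} (hs : s ∈ degreeSpan (k := k) p m) (j : ℤ) :
    p j * s ∈ degreeSpan (k := k) p (j + m) := by
  suffices degreeSpan p m ≤ (degreeSpan p (j + m)).comap (LinearMap.mulLeft k (p j)) from this hs
  refine Submodule.span_le.2 ?_
  rintro _ ⟨l, hl, rfl⟩
  exact Submodule.subset_span ⟨j :: l, by simp [hl], by simp⟩

lemma degreeSpan_induction {p : ℤ → S} {C : ℤ → S → Prop} (hone : C 0 1)
    (hzero : ∀ m, C m 0) (hadd : ∀ m s t, C m s → C m t → C m (s + t))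
    (hsmul : ∀ m (c : k) s, C m s → C m (c • s)) (hmul : ∀ m j s, C m s → C (j + m) (p j * s))
    {m : ℤ} {s : S} (hs : s ∈ degreeSpan (k := k) p m) : C m s := by
  induction hs using Submodule.span_induction with
  | zero => exact hzero m
  | add s t _ _ hs ht => exact hadd m s t hs ht
  | smul c s _ hs => exact hsmul m c s hs
  | mem s hs =>
    obtain ⟨l, hl, rfl⟩ := hs
    subst hl
    induction l with
    | nil => simpa using hone
    | cons j l ih => simpa using hmul _ j _ ih

lemma iSup_degreeSpan_eq_top {p : ℤ → S} (hp : Algebra.adjoin k (Set.range p) = ⊤) :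
    ⨆ m, degreeSpan (k := k) p m = ⊤ := by
  rw [eq_top_iff, ← Algebra.top_toSubmodule, ← hp, Algebra.adjoin_eq_span, Submodule.span_le]
  intro s hs
  induction hs using Submonoid.closure_induction_left with
  | one => exact Submodule.mem_iSup_of_mem 0 (one_mem_degreeSpan p)
  | mul_left a ha s _ hs =>
    obtain ⟨j, rfl⟩ := ha
    suffices ⨆ m, degreeSpan p m ≤
        (⨆ m, degreeSpan p m).comap (LinearMap.mulLeft k (p j)) from this hs
    exact iSup_le fun m t ht => Submodule.mem_iSup_of_mem (j + m) (mul_mem_degreeSpan ht j)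

/-- The elements `p j` satisfy a homogeneous linear recurrence of length `n` whose extreme
coefficients are invertible. -/
structure HasRecurrence (k : Type*) [Field k] {S : Type*} [CommRing S] [Algebra k S]
    (p : ℤ → S) (n : ℕ) (c : ℕ → S) : Prop where
  top_eq_one : c n = 1
  isUnit_zero : IsUnit (c 0)
  mem_degreeSpan : ∀ i ≤ n, c i ∈ degreeSpan (k := k) p (n - i)
  sum_eq_zero : ∀ m : ℤ, ∑ i ∈ Finset.range (n + 1), c i * p (i + m) = 0

/-- Generators are the coefficients `c i`, the inverse of `c 0` and the window `p 0, …, p (n - 1)`: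
the recurrence yields all later `p j`, and dividing by `c 0` all earlier ones. -/
lemma HasRecurrence.finiteType {p : ℤ → S} {n : ℕ} {c : ℕ → S} (hc : HasRecurrence k p n c)
    (hp : Algebra.adjoin k (Set.range p) = ⊤) : Algebra.FiniteType k S := by
  classical
  obtain ⟨d, hd⟩ := hc.isUnit_zero.exists_left_inv
  let G : Finset S := insert d ((Finset.range (n + 1)).image c ∪
    (Finset.range n).image fun i : ℕ => p i)
  have hcG : ∀ i ≤ n, c i ∈ Algebra.adjoin k (G : Set S) := fun i hi =>
    Algebra.subset_adjoin <| Finset.mem_coe.2 <| Finset.mem_insert_of_mem <| Finset.mem_union_left _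
      (Finset.mem_image_of_mem c (Finset.mem_range.2 (by omega)))
  have hdG : d ∈ Algebra.adjoin k (G : Set S) :=
    Algebra.subset_adjoin <| Finset.mem_coe.2 <| Finset.mem_insert_self _ _
  have hpG : ∀ j, p j ∈ Algebra.adjoin k (G : Set S) := by
    refine int_window_induction n ?_ ?_ ?_
    · exact fun i hi => Algebra.subset_adjoin <| Finset.mem_coe.2 <| Finset.mem_insert_of_mem <|
        Finset.mem_union_right _ (Finset.mem_image_of_mem (fun i : ℕ => p i) (Finset.mem_range.2 hi))
    · intro j hj
      have h1 := hc.sum_eq_zero j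
      rw [Finset.sum_range_succ, hc.top_eq_one, one_mul] at h1
      rw [eq_neg_of_add_eq_zero_right h1]
      refine neg_mem (sum_mem fun i hi => ?_)
      have hi := Finset.mem_range.1 hi
      exact mul_mem (hcG i hi.le) (hj i hi)
    · intro j hj
      have h1 := hc.sum_eq_zero j
      rw [Finset.sum_range_succ', Nat.cast_zero, zero_add] at h1
      have h2 : p j = d * (c 0 * p j) := by rw [← mul_assoc, hd, one_mul]
      rw [h2, eq_neg_of_add_eq_zero_right h1]
      refine mul_mem hdG (neg_mem (sum_mem fun i hi => ?_))
      have hi := Finset.mem_range.1 hi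
      exact mul_mem (hcG _ hi) (hj i hi)
  refine ⟨⟨G, ?_⟩⟩
  rw [eq_top_iff, ← hp]
  exact Algebra.adjoin_le (Set.range_subset_iff.2 hpG)

variable {R : Type*} [CommRing R] [Algebra k R] {n : ℕ}

/-- The power sums, with exponents in `ℤ`, of a family of units. -/
def powerSum (x : Fin n → Rˣ) (j : ℤ) : R := ∑ a, ((x a ^ j : Rˣ) : R)

/-- Newton's identities express `m` times the `m`-th elementary symmetric function through lower
ones and power sums; characteristic zero allows division by `m`. -/
lemma aeval_esymm_mem_degreeSpan [CharZero k] (x : Fin n → Rˣ) (m : ℕ) :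
    MvPolynomial.aeval (fun a => (x a : R)) (MvPolynomial.esymm (Fin n) k m) ∈
      degreeSpan (k := k) (powerSum x) m := by
  induction m using Nat.strong_induction_on with
  | _ m ih =>
    rcases Nat.eq_zero_or_pos m with rfl | hm
    · simpa using one_mem_degreeSpan (k := k) (powerSum x)
    have hm0 : (m : k) ≠ 0 := by exact_mod_cast hm.ne'
    rw [← Submodule.smul_mem_iff _ hm0]
    have h1 := congrArg (MvPolynomial.aeval fun a => (x a : R))
      (MvPolynomial.mul_esymm_eq_sum (Fin n) k m)
    have hpow : ∀ (t : ℕ) (r : R), r ∈ degreeSpan (k := k) (powerSum x) m →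
        (-1) ^ t * r ∈ degreeSpan (k := k) (powerSum x) m := fun t r hr => by
      rcases neg_one_pow_eq_or R t with ht | ht <;> simp [ht, hr]
    rw [map_mul, map_natCast] at h1
    rw [← algebraMap_smul R, map_natCast, smul_eq_mul, h1, map_mul, map_pow, map_neg, map_one,
      map_sum]
    refine hpow _ _ (Submodule.sum_mem _ fun a ha => ?_)
    rw [Finset.mem_filter, Finset.HasAntidiagonal.mem_antidiagonal] at ha
    rw [mul_assoc, map_mul, map_pow, map_neg, map_one, map_mul]
    refine hpow _ _ ?_
    have h2 : MvPolynomial.aeval (fun a => (x a : R)) (MvPolynomial.psum (Fin n) k a.2) =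
        powerSum x a.2 := by simp [MvPolynomial.psum, powerSum]
    have h3 : (m : ℤ) = a.2 + a.1 := by omega
    rw [h2, mul_comm, h3]
    exact mul_mem_degreeSpan (ih a.1 ha.2) _

lemma degreeSpan_le_adjoin (p : ℤ → S) (m : ℤ) :
    degreeSpan (k := k) p m ≤ Subalgebra.toSubmodule (Algebra.adjoin k (Set.range p)) := by
  refine Submodule.span_le.2 ?_
  rintro _ ⟨l, -, rfl⟩
  refine (Algebra.adjoin k (Set.range p)).list_prod_mem fun s hs => ?_
  obtain ⟨j, -, rfl⟩ := List.mem_map.1 hs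
  exact Algebra.subset_adjoin ⟨j, rfl⟩

variable (k) in
/-- The algebra generated by the power sums of a family of units. -/
abbrev powerSumAlgebra (x : Fin n → Rˣ) : Subalgebra k R :=
  Algebra.adjoin k (Set.range (powerSum x))

variable (k) in
/-- The power sums as elements of the algebra which they generate. -/
def powerSum' (x : Fin n → Rˣ) (j : ℤ) : powerSumAlgebra k x :=
  ⟨powerSum x j, Algebra.subset_adjoin ⟨j, rfl⟩⟩

lemma adjoin_powerSum' (x : Fin n → Rˣ) : Algebra.adjoin k (Set.range (powerSum' k x)) = ⊤ := by
  have h1 : Set.range (powerSum' k x) =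
      ((↑) : powerSumAlgebra k x → R) ⁻¹' Set.range (powerSum x) := by
    ext s
    simp [powerSum', Subtype.ext_iff]
  rw [h1]
  exact Algebra.adjoin_adjoin_coe_preimage

/-- The recurrence coefficients must lie in the algebra of power sums, with the right degree there:
preimages of submodules of `M̄(0)` are stable under that algebra, but not obviously under all
Laurent polynomials. -/
lemma exists_mem_degreeSpan_powerSum' (x : Fin n → Rˣ) {m : ℤ} {r : R}
    (hr : r ∈ degreeSpan (k := k) (powerSum x) m) :
    ∃ s ∈ degreeSpan (k := k) (powerSum' k x) m, (s : R) = r := by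
  refine degreeSpan_induction (k := k) (p := powerSum x)
    (C := fun m r => ∃ s ∈ degreeSpan (k := k) (powerSum' k x) m, (s : R) = r)
    ⟨1, one_mem_degreeSpan _, rfl⟩ (fun m => ⟨0, zero_mem _, rfl⟩) ?_ ?_ ?_ hr
  · rintro m _ _ ⟨s, hs, rfl⟩ ⟨t, ht, rfl⟩
    exact ⟨s + t, add_mem hs ht, rfl⟩
  · rintro m c _ ⟨s, hs, rfl⟩
    exact ⟨c • s, Submodule.smul_mem _ _ hs, rfl⟩
  · rintro m j _ ⟨s, hs, rfl⟩
    exact ⟨powerSum' k x j * s, mul_mem_degreeSpan hs j, rfl⟩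

/-- The power sums satisfy the recurrence given by the elementary symmetric functions. -/
lemma exists_hasRecurrence [CharZero k] (x : Fin n → Rˣ) :
    ∃ c, HasRecurrence k (powerSum' k x) n c := by
  let E : (Fin n → Rˣ) → ℕ → R := fun x m =>
    MvPolynomial.aeval (fun a => (x a : R)) (MvPolynomial.esymm (Fin n) k m)
  have hEn : ∀ x, E x n = ∏ a, (x a : R) := fun x => by
    have : Finset.powersetCard n (Finset.univ : Finset (Fin n)) = {Finset.univ} := by
      simpa using Finset.powersetCard_self (Finset.univ : Finset (Fin n))
    simp [E, MvPolynomial.esymm, this]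
  have hEmem : ∀ i ≤ n, ((-1) ^ (n - i) * E x (n - i) : R) ∈
      degreeSpan (k := k) (powerSum x) (n - i) := fun i hi => by
    have := aeval_esymm_mem_degreeSpan (k := k) x (n - i)
    rw [Nat.cast_sub hi] at this
    rcases neg_one_pow_eq_or R (n - i) with ht | ht <;> simpa [ht] using this
  -- Past `n` the coefficient is the default `0`; the recurrence never sees it.
  have hex : ∀ i : ℕ, ∃ s : powerSumAlgebra k x, i ≤ n →
      s ∈ degreeSpan (k := k) (powerSum' k x) (n - i) ∧
        (s : R) = (-1) ^ (n - i) * E x (n - i) := fun i => by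
    by_cases hi : i ≤ n
    · obtain ⟨s, hs, hs'⟩ := exists_mem_degreeSpan_powerSum' x (hEmem i hi)
      exact ⟨s, fun _ => ⟨hs, hs'⟩⟩
    · exact ⟨0, fun hh => absurd hh hi⟩
  choose c hc using hex
  -- By Vieta the `c i` are the coefficients of the monic polynomial with roots `x a`.
  have hroot : ∀ a, ∑ i ∈ Finset.range (n + 1), (c i : R) * (x a : R) ^ i = 0 := fun a => by
    have h1 := congrArg (Polynomial.eval (x a : R)) (Multiset.prod_X_sub_X_eq_sum_esymm
      (Multiset.map (fun a => (x a : R)) (Finset.univ : Finset (Fin n)).val))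
    have h2 : Polynomial.eval (x a : R) (Multiset.map (fun t => Polynomial.X - Polynomial.C t)
        (Multiset.map (fun a => (x a : R)) (Finset.univ : Finset (Fin n)).val)).prod = 0 := by
      rw [Multiset.map_map]
      change Polynomial.eval _ (∏ b, (Polynomial.X - Polynomial.C (x b : R))) = 0
      rw [Polynomial.eval_prod]
      exact Finset.prod_eq_zero (Finset.mem_univ a) (by simp)
    rw [h2, Polynomial.eval_finsetSum] at h1
    simp only [Multiset.card_map, Finset.card_val, Finset.card_univ, Fintype.card_fin] at h1
    rw [h1, ← Finset.sum_range_reflect]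
    refine Finset.sum_congr rfl fun i hi => ?_
    have hi : i ≤ n := by have := Finset.mem_range.1 hi; omega
    have hn : n + 1 - 1 - i = n - i := by omega
    have hni : n - (n - i) = i := by omega
    rw [hn, (hc (n - i) (by omega)).2, hni]
    simp only [Polynomial.eval_mul, Polynomial.eval_pow, Polynomial.eval_neg, Polynomial.eval_one,
      Polynomial.eval_C, Polynomial.eval_X]
    rw [← MvPolynomial.aeval_esymm_eq_multiset_esymm (Fin n) k, mul_assoc]
  refine ⟨c, ⟨?_, ?_, fun i hi => (hc i hi).1, fun m => ?_⟩⟩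
  · apply Subtype.ext
    rw [(hc n le_rfl).2]
    simp [E]
  -- Up to sign `c 0` is the product of the `x a`. Its inverse is the top elementary symmetric
  -- function of the inverses, whose power sums are those of `x` with negated exponents.
  · have h1 : E (fun a => (x a)⁻¹) n ∈ powerSumAlgebra k x := by
      have h2 : powerSumAlgebra k (fun a => (x a)⁻¹) ≤ powerSumAlgebra k x := by
        refine Algebra.adjoin_le (Set.range_subset_iff.2 fun j => ?_)
        have : powerSum (fun a => (x a)⁻¹) j = powerSum x (-j) := by
          simp only [powerSum, inv_zpow, zpow_neg]
        rw [this]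
        exact Algebra.subset_adjoin ⟨_, rfl⟩
      exact h2 (degreeSpan_le_adjoin _ _ (aeval_esymm_mem_degreeSpan (k := k) _ n))
    have h3 : E x n * E (fun a => (x a)⁻¹) n = 1 := by
      rw [hEn, hEn, ← Finset.prod_mul_distrib]
      simp
    refine IsUnit.of_mul_eq_one ((-1) ^ n * ⟨_, h1⟩) (Subtype.ext ?_)
    have h4 : ((-1) ^ n * (-1) ^ n : R) = 1 := by rw [← mul_pow]; simp
    simp only [MulMemClass.coe_mul, (hc 0 (Nat.zero_le n)).2, Nat.sub_zero, SubmonoidClass.coe_pow,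
      NegMemClass.coe_neg, OneMemClass.coe_one]
    rw [mul_mul_mul_comm, h4, h3, one_mul]
  · apply Subtype.ext
    rw [AddSubmonoidClass.coe_finsetSum]
    simp only [MulMemClass.coe_mul, powerSum', powerSum, Finset.mul_sum, ZeroMemClass.coe_zero]
    rw [Finset.sum_comm]
    -- For each `a` the sum is the polynomial relation at the root `x a`, multiplied by `x a ^ m`.
    refine Finset.sum_eq_zero fun a _ => ?_
    have : ∀ i : ℕ, (c i : R) * ((x a ^ ((i : ℤ) + m) : Rˣ) : R) =
        (c i : R) * (x a : R) ^ i * ((x a ^ m : Rˣ) : R) := fun i => by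
      rw [zpow_add, zpow_natCast, Units.val_mul, Units.val_pow_eq_pow_val, mul_assoc]
    simp only [this, ← Finset.sum_mul, hroot, zero_mul]

end PowerSums


/-! ### Generation of `M̄(0)` by its generator. -/

section Generation

attribute [local instance 100] LieRing.ofAssociativeRing

/-- The universal enveloping algebra is generated by the Lie algebra. -/
lemma adjoin_range_ι_eq_top (R L : Type*) [CommRing R] [LieRing L] [LieAlgebra R L] :
    Algebra.adjoin R (Set.range (UniversalEnvelopingAlgebra.ι R : L → _)) = ⊤ := by
  let A := Algebra.adjoin R (Set.range (UniversalEnvelopingAlgebra.ι R : L → _))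
  let j : L →ₗ⁅R⁆ A :=
    { toFun := fun x => ⟨UniversalEnvelopingAlgebra.ι R x, Algebra.subset_adjoin ⟨x, rfl⟩⟩
      map_add' := fun x y => Subtype.ext (map_add _ x y)
      map_smul' := fun c x => Subtype.ext (map_smul _ c x)
      map_lie' := fun {x y} => Subtype.ext (LieHom.map_lie _ x y) }
  -- By the universal property the identity factors through the subalgebra, which is therefore
  -- everything.
  have hid : A.val.comp (UniversalEnvelopingAlgebra.lift R j) = AlgHom.id R _ := by
    apply UniversalEnvelopingAlgebra.hom_ext
    ext x
    change A.val (UniversalEnvelopingAlgebra.lift R j (UniversalEnvelopingAlgebra.ι R x)) = _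
    rw [UniversalEnvelopingAlgebra.lift_ι_apply]
    rfl
  rw [eq_top_iff]
  intro u _
  have := DFunLike.congr_fun hid u
  rw [AlgHom.id_apply] at this
  rw [← this]
  exact (UniversalEnvelopingAlgebra.lift R j u).2

variable (k : Type*) [Field k]

lemma lie_gen_of_mem_borel {x : Loop k} (hx : x ∈ borel k) : ⁅x, gen k⁆ = 0 := by
  change UniversalEnvelopingAlgebra.ι k x • gen k = 0
  rw [gen]
  refine (Submodule.Quotient.mk_smul _ _ _).symm.trans ?_
  rw [TensorProduct.smul_tmul', smul_eq_mul, mul_one]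
  refine (Submodule.Quotient.mk_eq_zero _).2 (Submodule.subset_span
    ⟨⟨x, hx⟩, (TrivialLieModule.equiv k (borel k) k).symm 1, ?_⟩)
  rw [trivial_lie_zero, TensorProduct.tmul_zero, sub_zero]

lemma lie_h_gen (j : ℤ) : ⁅loop (h k) j, gen k⁆ = 0 :=
  lie_gen_of_mem_borel k (Submodule.subset_span (Or.inl ⟨j, rfl⟩))

lemma lie_e_gen (j : ℤ) : ⁅loop (e k) j, gen k⁆ = 0 :=
  lie_gen_of_mem_borel k (Submodule.subset_span (Or.inr ⟨j, rfl⟩))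

lemma eq_top_of_gen_mem {N : LieSubmodule k (Loop k) (MBar k)} (hN : gen k ∈ N) : N = ⊤ := by
  have hU : ∀ u : UniversalEnvelopingAlgebra k (Loop k), ∀ m ∈ N, u • m ∈ N := by
    intro u
    have hu : u ∈ Algebra.adjoin k
        (Set.range (UniversalEnvelopingAlgebra.ι k : Loop k → _)) := by
      rw [adjoin_range_ι_eq_top]; trivial
    induction hu using Algebra.adjoin_induction with
    | mem u hu => obtain ⟨x, rfl⟩ := hu; exact fun m hm => N.lie_mem hm
    | algebraMap c => intro m hm; rw [algebraMap_smul]; exact N.smul_mem c hm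
    | add u v _ _ hu hv => intro m hm; rw [add_smul]; exact N.add_mem (hu m hm) (hv m hm)
    | mul u v _ _ hu hv => intro m hm; rw [mul_smul]; exact hu _ (hv m hm)
  rw [eq_top_iff]
  intro m _
  obtain ⟨z, rfl⟩ := Submodule.Quotient.mk_surjective _ m
  induction z using TensorProduct.induction_on with
  | zero => exact N.zero_mem
  | add y z hy hz => exact N.add_mem (hy trivial) (hz trivial)
  | tmul u w =>
    have hw : w = (TrivialLieModule.equiv k (borel k) k w) •
        (TrivialLieModule.equiv k (borel k) k).symm 1 := by
      rw [← map_smul, smul_eq_mul, mul_one, LinearEquiv.symm_apply_apply]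
    rw [hw, TensorProduct.tmul_smul]
    refine N.smul_mem (TrivialLieModule.equiv k (borel k) k w)
      (x := Submodule.Quotient.mk (u ⊗ₜ[k] (TrivialLieModule.equiv k (borel k) k).symm 1)) ?_
    have := hU u _ hN
    rw [gen] at this
    have h2 : u ⊗ₜ[k] (TrivialLieModule.equiv k (borel k) k).symm 1 =
        u • ((1 : UniversalEnvelopingAlgebra k (Loop k)) ⊗ₜ[k]
          (TrivialLieModule.equiv k (borel k) k).symm 1) := by
      rw [TensorProduct.smul_tmul', smul_eq_mul, mul_one]
    rw [h2]
    exact this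

end Generation

/-! ### Laurent polynomials and the layers of `M̄(0)`. -/

section Words

variable (k : Type*) [Field k]

/-- The vector `f(i₁) ⋯ f(iₙ) v` of `M̄(0)`, where `v` is the generator. -/
def fWord : ∀ {n : ℕ}, (Fin n → ℤ) → MBar k
  | 0, _ => gen k
  | _ + 1, i => ⁅loop (f k) (i 0), fWord (Fin.tail i)⁆

/-- Since `h(j)` kills the generator, only the commutators with the letters remain, and each shifts
one exponent by `j`. -/
lemma lie_h_fWord {n : ℕ} (i : Fin n → ℤ) (j : ℤ) :
    ⁅loop (h k) j, fWord k i⁆ = (-2 : k) • ∑ a, fWord k (Pi.single a j + i) := by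
  induction n with
  | zero => simp [fWord, lie_h_gen]
  | succ n ih =>
    rw [fWord, lie_h_lie_f, ih, Fin.sum_univ_succ, smul_add, lie_smul, lie_sum]
    congr 2
    · simp only [fWord, Pi.add_apply, Pi.single_eq_same]
      congr 2
      funext b
      simp [Fin.tail]
    · refine Finset.sum_congr rfl fun a _ => ?_
      simp only [fWord, Pi.add_apply]
      rw [Pi.single_eq_of_ne (Fin.succ_ne_zero a).symm, zero_add]
      congr 2
      funext b
      simp [Fin.tail, Pi.single_apply]

/-- Laurent polynomials in `n` variables. -/
abbrev Laurent (n : ℕ) : Type _ := AddMonoidAlgebra k (Fin n → ℤ)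

/-- The variables of the ring of Laurent polynomials. -/
def laurentVar {n : ℕ} (a : Fin n) : (Laurent k n)ˣ where
  val := AddMonoidAlgebra.single (Pi.single a 1) 1
  inv := AddMonoidAlgebra.single (Pi.single a (-1)) 1
  val_inv := by
    rw [AddMonoidAlgebra.single_mul_single, ← Pi.single_add]
    simp [AddMonoidAlgebra.one_def]
  inv_val := by
    rw [AddMonoidAlgebra.single_mul_single, ← Pi.single_add]
    simp [AddMonoidAlgebra.one_def]

lemma laurentVar_zpow {n : ℕ} (a : Fin n) (j : ℤ) :
    ((laurentVar k a ^ j : (Laurent k n)ˣ) : Laurent k n) =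
      AddMonoidAlgebra.single (Pi.single a j) 1 := by
  have hnat : ∀ m : ℕ, ((laurentVar k a ^ m : (Laurent k n)ˣ) : Laurent k n) =
      AddMonoidAlgebra.single (Pi.single a (m : ℤ)) 1 := fun m => by
    rw [Units.val_pow_eq_pow_val, laurentVar, AddMonoidAlgebra.single_pow, one_pow, ← Pi.single_smul]
    simp
  have hinv : ∀ m : ℕ, (((laurentVar k a)⁻¹ ^ m : (Laurent k n)ˣ) : Laurent k n) =
      AddMonoidAlgebra.single (Pi.single a (-m : ℤ)) 1 := fun m => by
    rw [Units.val_pow_eq_pow_val, laurentVar, Units.inv_mk, AddMonoidAlgebra.single_pow, one_pow,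
      ← Pi.single_smul]
    simp
  rcases Int.eq_nat_or_neg j with ⟨m, rfl | rfl⟩
  · rw [zpow_natCast, hnat]
  · rw [zpow_neg, zpow_natCast, ← inv_pow, hinv]

/-- The map from Laurent polynomials in `n` variables to `M̄(0)` which sends the monomial with
exponents `i₁, …, iₙ` to `f(i₁) ⋯ f(iₙ) v`. -/
def laurentMap (n : ℕ) : Laurent k n →ₗ[k] MBar k :=
  Finsupp.linearCombination k (fWord k) ∘ₗ (AddMonoidAlgebra.coeffLinearEquiv k).toLinearMap

lemma laurentMap_single {n : ℕ} (i : Fin n → ℤ) (c : k) :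
    laurentMap k n (AddMonoidAlgebra.single i c) = c • fWord k i := by
  simp [laurentMap]

lemma laurentMap_powerSum_mul {n : ℕ} (j : ℤ) (g : Laurent k n) :
    (-2 : k) • laurentMap k n (powerSum (laurentVar k) j * g) =
      ⁅loop (h k) j, laurentMap k n g⁆ := by
  induction g using AddMonoidAlgebra.induction_linear with
  | zero => simp
  | add g g' hg hg' => rw [mul_add, map_add, smul_add, hg, hg', map_add, lie_add]
  | single i c =>
    rw [laurentMap_single, lie_smul, lie_h_fWord, powerSum, Finset.sum_mul, map_sum, smul_comm c,
      Finset.smul_sum (r := c)]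
    congr 1
    refine Finset.sum_congr rfl fun a _ => ?_
    rw [laurentVar_zpow, AddMonoidAlgebra.single_mul_single, one_mul, laurentMap_single]

lemma fWord_mem_layer {n : ℕ} (i : Fin n → ℤ) : fWord k i ∈ layer (MBar k) (n : k) := by
  induction n with
  | zero => rw [mem_layer, fWord, lie_h_gen]; simp
  | succ n ih =>
    rw [Nat.cast_succ]
    exact lie_f_mem_layer (ih _) _

lemma range_laurentMap_le_layer (n : ℕ) :
    LinearMap.range (laurentMap k n) ≤ layer (MBar k) (n : k) := by
  rintro _ ⟨g, rfl⟩
  induction g using AddMonoidAlgebra.induction_linear with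
  | zero => simp
  | add g g' hg hg' => rw [map_add]; exact add_mem hg hg'
  | single i c => rw [laurentMap_single]; exact Submodule.smul_mem _ _ (fWord_mem_layer k i)

lemma iSup_range_laurentMap : ⨆ n, LinearMap.range (laurentMap k n) = ⊤ := by
  have hX : ∀ j, ∀ x ∈ Submodule.span k {gen k}, ⁅loop (h k) j, x⁆ = 0 := fun j x hx => by
    obtain ⟨c, rfl⟩ := Submodule.mem_span_singleton.1 hx
    rw [lie_smul, lie_h_gen, smul_zero]
  have hE : ∀ j, ∀ x ∈ Submodule.span k {gen k}, ⁅loop (e k) j, x⁆ = 0 := fun j x hx => by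
    obtain ⟨c, rfl⟩ := Submodule.mem_span_singleton.1 hx
    rw [lie_smul, lie_e_gen, smul_zero]
  have hstage : ∀ n, fStage (Submodule.span k {gen k}) n ≤ LinearMap.range (laurentMap k n) := by
    intro n
    induction n with
    | zero =>
      rw [fStage, Submodule.span_singleton_le_iff_mem]
      exact ⟨AddMonoidAlgebra.single 0 1, by rw [laurentMap_single, one_smul]; rfl⟩
    | succ n ih =>
      refine fStage_succ_le fun j v hv => ?_
      obtain ⟨g, rfl⟩ := ih hv
      clear hv
      induction g using AddMonoidAlgebra.induction_linear with
      | zero => simp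
      | add g g' hg hg' => rw [map_add, lie_add]; exact add_mem hg hg'
      | single i c =>
        rw [laurentMap_single, lie_smul]
        refine Submodule.smul_mem _ _ ⟨AddMonoidAlgebra.single (Fin.cons j i) 1, ?_⟩
        rw [laurentMap_single, one_smul, fWord, Fin.tail_cons, Fin.cons_zero]
  have htop := eq_top_of_gen_mem k
    (le_fSpan (fun j x hx => by rw [hX j x hx]; exact zero_mem _) hE
      (Submodule.mem_span_singleton_self (gen k)))
  rw [eq_top_iff]
  refine le_trans ?_ (iSup_mono hstage)
  intro m _
  have : m ∈ (⊤ : LieSubmodule k (Loop k) (MBar k)) := trivial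
  rw [← htop] at this
  exact this

/-- The images of the `laurentMap k n` span `M̄(0)` and lie in layers that are distinct in
characteristic zero. Injectivity of `laurentMap`, of PBW type, is not needed. -/
lemma layer_MBar_eq [CharZero k] (n : ℕ) :
    layer (MBar k) (n : k) = LinearMap.range (laurentMap k n) := by
  refine le_antisymm ?_ (range_laurentMap_le_layer k n)
  refine (layer_le_iSup_of_iSup_eq_top (c := fun n : ℕ => (n : k))
    (range_laurentMap_le_layer k) (iSup_range_laurentMap k) n).trans ?_
  exact iSup₂_le fun m hm => by rw [Nat.cast_injective hm]

end Words

/-! ### Laurent polynomials acting on subquotients. -/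

section Subquotient

variable {k : Type*} [Field k] [CharZero k]
  {Q : Type*} [AddCommGroup Q] [Module k Q] [LieRingModule (Loop k) Q]

/-- The Laurent polynomials whose image in `M̄(0)` lies in a given submodule. -/
def laurentPreimage (N : LieSubmodule k (Loop k) (MBar k)) (n : ℕ) :
    Submodule (powerSumAlgebra k (laurentVar k (n := n))) (Laurent k n) where
  carrier := {g | laurentMap k n g ∈ N}
  zero_mem' := by simp
  add_mem' {g g'} hg hg' := by
    change laurentMap k n (g + g') ∈ N
    rw [map_add]; exact N.add_mem hg hg'
  smul_mem' := by
    rintro ⟨s, hs⟩ g hg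
    change laurentMap k n (s * g) ∈ N
    change laurentMap k n g ∈ N at hg
    induction hs using Algebra.adjoin_induction generalizing g with
    | mem s hs =>
      obtain ⟨j, rfl⟩ := hs
      have h2 : (-2 : k) ≠ 0 := by norm_num
      have := N.lie_mem (x := loop (h k) j) hg
      rw [← laurentMap_powerSum_mul] at this
      exact (N.toSubmodule.smul_mem_iff h2).1 this
    | algebraMap c =>
      rw [← Algebra.smul_def, map_smul]
      exact N.smul_mem c hg
    | add s t _ _ hs ht => rw [add_mul, map_add]; exact N.add_mem (hs hg) (ht hg)
    | mul s t _ _ hs ht => rw [mul_assoc]; exact hs (ht hg)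

variable {N : LieSubmodule k (Loop k) (MBar k)} (ρ : N →ₗ⁅k, Loop k⁆ Q)

/-- The map from Laurent polynomials to a quotient of a submodule of `M̄(0)`. -/
def laurentToQuotient (n : ℕ) : laurentPreimage N n →ₗ[k] Q where
  toFun g := ρ ⟨laurentMap k n g.1, g.2⟩
  map_add' g g' := by
    rw [← map_add]
    exact congrArg ρ (Subtype.ext (map_add (laurentMap k n) g.1 g'.1))
  map_smul' c g := by
    rw [RingHom.id_apply, ← map_smul]
    exact congrArg ρ (Subtype.ext (map_smul (laurentMap k n) c g.1))

lemma laurentToQuotient_powerSum_smul {n : ℕ} (j : ℤ) (g : laurentPreimage N n) :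
    (-2 : k) • laurentToQuotient ρ n (powerSum' k (laurentVar k (n := n)) j • g) =
      ⁅loop (h k) j, laurentToQuotient ρ n g⁆ := by
  change (-2 : k) • ρ _ = ⁅loop (h k) j, ρ _⁆
  rw [← map_smul, ← LieModuleHom.map_lie]
  exact congrArg ρ (Subtype.ext (laurentMap_powerSum_mul k j g.1))

lemma range_laurentToQuotient_le_layer [LieModule k (Loop k) Q] (n : ℕ) :
    LinearMap.range (laurentToQuotient ρ n) ≤ layer Q (n : k) := by
  rintro _ ⟨g, rfl⟩
  have hg := mem_layer.1 (range_laurentMap_le_layer k n ⟨g.1, rfl⟩)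
  rw [mem_layer]
  change ⁅_, ρ _⁆ = _ • ρ _
  rw [← map_smul, ← LieModuleHom.map_lie]
  exact congrArg ρ (Subtype.ext hg)

/-- As `h(0)` is diagonalizable on `M̄(0)`, the submodule `N` is the sum of its intersections with
the layers, each of which comes from Laurent polynomials. -/
lemma iSup_range_laurentToQuotient (hρ : Function.Surjective ρ) :
    ⨆ n, LinearMap.range (laurentToQuotient ρ n) = ⊤ := by
  let T := LieModule.toEnd k (Loop k) (MBar k) (loop (h k) 0)
  -- Layer `a` has eigenvalue `-2 a`, so the eigenvalue `μ` belongs to the index `-(μ / 2)`.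
  have hlayer : ∀ μ : k, T.eigenspace μ = layer (MBar k) (-(μ / 2)) := fun μ => by
    rw [layer]; congr 1; ring
  have hT : ⨆ μ, T.eigenspace μ = ⊤ := by
    rw [eq_top_iff, ← iSup_range_laurentMap k]
    exact iSup_le fun n => (range_laurentMap_le_layer k n).trans (le_iSup T.eigenspace _)
  let D : Submodule k (MBar k) :=
    ((⨆ n, LinearMap.range (laurentToQuotient ρ n)).comap (ρ : N →ₗ[k] Q)).map
      N.toSubmodule.subtype
  have hND : N.toSubmodule ≤ D := by
    refine (le_iSup_inf_eigenspace (T := T) (fun x hx => N.lie_mem hx) hT).trans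
      (iSup_le fun μ => ?_)
    rintro x ⟨hxN, hx⟩
    rw [hlayer] at hx
    have hx' := layer_le_iSup_of_iSup_eq_top (c := fun n : ℕ => (n : k))
      (range_laurentMap_le_layer k) (iSup_range_laurentMap k) _ hx
    by_cases hn : ∃ n : ℕ, (n : k) = -(μ / 2)
    · obtain ⟨n, hn⟩ := hn
      rw [← hn, layer_MBar_eq] at hx
      obtain ⟨g, rfl⟩ := hx
      exact ⟨⟨laurentMap k n g, hxN⟩, Submodule.mem_iSup_of_mem n ⟨⟨g, hxN⟩, rfl⟩, rfl⟩
    · push Not at hn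
      simp only [hn, iSup_false, iSup_bot, Submodule.mem_bot] at hx'
      rw [hx']
      exact zero_mem _
  rw [eq_top_iff]
  intro q _
  obtain ⟨y, rfl⟩ := hρ q
  obtain ⟨y', hy', hyy⟩ := hND y.2
  obtain rfl : y' = y := Subtype.ext hyy
  exact hy'

end Subquotient


lemma finite_range_of_ker_le {k D A B : Type*} [Field k] [AddCommGroup D] [Module k D]
    [AddCommGroup A] [Module k A] [AddCommGroup B] [Module k B] [Module.Finite k A]
    (u : D →ₗ[k] A) (g : D →ₗ[k] B) (hle : LinearMap.ker u ≤ LinearMap.ker g) :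
    Module.Finite k (LinearMap.range g) := by
  have : Module.Finite k (D ⧸ LinearMap.ker u) :=
    Module.Finite.equiv u.quotKerEquivRange.symm
  rw [← Submodule.range_liftQ (LinearMap.ker u) g hle]
  infer_instance

/-! ### Layers of a graded irreducible module. -/

section Irreducible

variable {k : Type*} [Field k] [CharZero k] {V : Type*} [AddCommGroup V] [Module k V]
  [LieRingModule (Loop k) V] [LieModule k (Loop k) V] {𝒱 : ℤ → Submodule k V}

/-- In a graded module on which `h(0)` is diagonalizable every layer is a graded subspace. -/
lemma IsGrading.layer_le_iSup (hg : IsGrading 𝒱) (htop : ⨆ a : k, layer V a = ⊤) (a : k) :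
    layer V a ≤ ⨆ d, layer V a ⊓ 𝒱 d := by
  let T := LieModule.toEnd k (Loop k) V (loop (h k) 0)
  have hlayer : ∀ μ : k, T.eigenspace μ = layer V (-(μ / 2)) := fun μ => by
    rw [layer]; congr 1; ring
  have hT : ⨆ μ, T.eigenspace μ = ⊤ := by
    rw [eq_top_iff, ← htop]
    exact iSup_le fun b => le_iSup T.eigenspace _
  -- `h(0)` has degree zero, so it preserves each `𝒱 d`, which therefore splits into eigenspaces.
  have h1 : ∀ d, 𝒱 d ≤ ⨆ x : ℤ × k, 𝒱 x.1 ⊓ layer V x.2 := fun d => by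
    refine (le_iSup_inf_eigenspace (T := T) (fun x hx => ?_) hT).trans (iSup_le fun μ => ?_)
    · simpa [T] using hg.lie_mem (h k) 0 d x hx
    · rw [hlayer]
      exact le_iSup (fun x : ℤ × k => 𝒱 x.1 ⊓ layer V x.2) (d, -(μ / 2))
  have h2 : ⨆ x : ℤ × k, 𝒱 x.1 ⊓ layer V x.2 = ⊤ := by
    rw [eq_top_iff, ← hg.isInternal.submodule_iSup_eq_top]
    exact iSup_le h1
  refine (layer_le_iSup_of_iSup_eq_top (c := Prod.snd) (fun x => inf_le_right) h2 a).trans ?_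
  refine iSup₂_le ?_
  rintro ⟨d, b⟩ rfl
  rw [inf_comm]
  exact le_iSup (fun d => layer V b ⊓ 𝒱 d) d

lemma IsGrading.exists_mem_layer_ne_zero (hg : IsGrading 𝒱) (htop : ⨆ a : k, layer V a = ⊤)
    {a : k} (ha : layer V a ≠ ⊥) : ∃ d, ∃ v ∈ layer V a ⊓ 𝒱 d, v ≠ 0 := by
  by_contra! hcon
  refine ha (eq_bot_iff.2 ((hg.layer_le_iSup htop a).trans (iSup_le fun d v hv => ?_)))
  exact (Submodule.mem_bot k).2 (hcon d v hv)

lemma layer_le_fStage {X : Submodule k V} {a : k} (hXa : X ≤ layer V a)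
    (htop : ⨆ r, fStage X r = ⊤) (r : ℕ) : layer V (a + r) ≤ fStage X r := by
  refine (layer_le_iSup_of_iSup_eq_top (fStage_le_layer hXa) htop (a + r)).trans ?_
  refine iSup₂_le fun s hs => ?_
  rw [Nat.cast_injective (add_left_cancel hs)]

lemma layer_eq_bot_of_ne {X : Submodule k V} {a b : k} (hXa : X ≤ layer V a)
    (htop : ⨆ r, fStage X r = ⊤) (hb : ∀ r : ℕ, a + r ≠ b) : layer V b = ⊥ := by
  rw [eq_bot_iff]
  refine (layer_le_iSup_of_iSup_eq_top (fStage_le_layer hXa) htop b).trans ?_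
  exact iSup₂_le fun s hs => absurd hs (hb s)

/-- A homogeneous vector annihilated by all `e(j)` lies in the lowest layer or vanishes. -/
lemma IsGradedIrreducible.eq_zero_of_lie_e_eq_zero (hg : IsGrading 𝒱)
    (hirr : IsGradedIrreducible 𝒱) {a : k} (ha : layer V a ≠ ⊥) {w : V} {d : ℤ}
    (hw : w ∈ layer V (a + 1)) (hwd : w ∈ 𝒱 d) (hwe : ∀ j, ⁅loop (e k) j, w⁆ = 0) : w = 0 := by
  by_contra hw0
  -- The vectors of layer `a + 1` killed by all `e(j)` form an `h`-stable space. If it contains `w ≠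
  -- 0`, words in the `f(j)` on it fill the module, yet they reach only the layers `a + 1 + r`,
  -- never `a`.
  let X : Submodule k V := layer V (a + 1) ⊓
    ⨅ j, LinearMap.ker (LieModule.toEnd k (Loop k) V (loop (e k) j))
  have hXe : ∀ x, x ∈ X ↔ x ∈ layer V (a + 1) ∧ ∀ j, ⁅loop (e k) j, x⁆ = 0 := fun x => by
    simp [X, Submodule.mem_iInf]
  have htop : ⨆ r, fStage X r = ⊤ := by
    refine hirr.iSup_fStage_eq_top hg (fun j x hx => ?_) (fun j x hx => ((hXe x).1 hx).2 j)
      ((hXe w).2 ⟨hw, hwe⟩) hwd hw0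
    obtain ⟨h1, h2⟩ := (hXe x).1 hx
    refine (hXe _).2 ⟨lie_h_mem_layer h1 j, fun i => ?_⟩
    have h3 := lie_h_lie_e (k := k) j i x
    rwa [h2, h2, lie_zero, smul_zero, zero_add, eq_comm] at h3
  refine ha (layer_eq_bot_of_ne (fun x hx => ((hXe x).1 hx).1) htop fun r hr => ?_)
  have h1 : ((r + 1 : ℕ) : k) = 0 := by
    push_cast
    linear_combination hr
  exact Nat.succ_ne_zero r (Nat.cast_eq_zero.1 h1)

end Irreducible

/-! ### Finiteness in the lowest layer and propagation upwards. -/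

section LowestLayer

variable {k : Type*} [Field k] [CharZero k] {V : Type*} [AddCommGroup V] [Module k V]
  [LieRingModule (Loop k) V] {𝒱 : ℤ → Submodule k V}
  {S : Type*} [CommRing S] [Algebra k S] {p : ℤ → S} {n : ℕ} {c : ℕ → S}
  {X : Type*} [AddCommGroup X] [Module S X] [Module k X] [IsScalarTower k S X]
  {ψ : X →ₗ[k] V}

lemma map_smul_mem_of_mem_degreeSpan (hg : IsGrading 𝒱)
    (hψ : ∀ j x, (-2 : k) • ψ (p j • x) = ⁅loop (h k) j, ψ x⁆) {m d : ℤ} {s : S}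
    (hs : s ∈ degreeSpan (k := k) p m) {x : X} (hx : ψ x ∈ 𝒱 d) : ψ (s • x) ∈ 𝒱 (m + d) := by
  have h2 : (-2 : k) ≠ 0 := neg_ne_zero.2 two_ne_zero
  refine degreeSpan_induction (C := fun m s => ψ (s • x) ∈ 𝒱 (m + d)) ?_ ?_ ?_ ?_ ?_ hs
  · simpa using hx
  · intro m; simp
  · intro m s t hs ht; rw [add_smul, map_add]; exact add_mem hs ht
  · intro m c s hs; rw [smul_assoc, map_smul]; exact Submodule.smul_mem _ _ hs
  · intro m j s hs
    rw [mul_smul, ← Submodule.smul_mem_iff _ h2, hψ, add_assoc]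
    exact hg.lie_mem (h k) j _ _ hs

/-- The kernel of `ψ` is `S`-stable, so `S` acts on the image of `ψ` although `V` itself is not an
`S`-module. -/
lemma map_smul_eq_zero (hp : Algebra.adjoin k (Set.range p) = ⊤)
    (hψ : ∀ j x, (-2 : k) • ψ (p j • x) = ⁅loop (h k) j, ψ x⁆) (s : S) {x : X} (hx : ψ x = 0) :
    ψ (s • x) = 0 := by
  have h2 : (-2 : k) ≠ 0 := neg_ne_zero.2 two_ne_zero
  have hs : s ∈ Algebra.adjoin k (Set.range p) := by rw [hp]; trivial
  induction hs using Algebra.adjoin_induction generalizing x with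
  | mem s hs =>
    obtain ⟨j, rfl⟩ := hs
    have := hψ j x
    rw [hx, lie_zero] at this
    exact (smul_eq_zero.1 this).resolve_left h2
  | algebraMap c => rw [algebraMap_smul, map_smul, hx, smul_zero]
  | add s t _ _ hs ht => rw [add_smul, map_add, hs hx, ht hx, add_zero]
  | mul s t _ _ hs ht => rw [mul_smul]; exact hs (ht hx)

variable [LieModule k (Loop k) V]

/-- The recurrence for the operators `h(j)` on the lowest layer passes to the operators `f(j)`. -/
lemma sum_lie_f_eq_zero (hg : IsGrading 𝒱) (hirr : IsGradedIrreducible 𝒱)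
    (htop : ⨆ a : k, layer V a = ⊤) (hc : HasRecurrence k p n c) {a : k}
    (hψ : ∀ j x, (-2 : k) • ψ (p j • x) = ⁅loop (h k) j, ψ x⁆)
    (hrange : LinearMap.range ψ = layer V a) (ha : layer V a ≠ ⊥)
    (hE : ∀ j, ∀ v ∈ layer V a, ⁅loop (e k) j, v⁆ = 0) (j : ℤ) (x : X) :
    ∑ i ∈ Finset.range (n + 1), ⁅loop (f k) (i + j), ψ (c i • x)⁆ = 0 := by
  have hmem : ∀ x, ψ x ∈ layer V a := fun x => hrange ▸ ⟨x, rfl⟩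
  have hhom : ∀ d x, ψ x ∈ 𝒱 d →
      ∑ i ∈ Finset.range (n + 1), ⁅loop (f k) (i + j), ψ (c i • x)⁆ = 0 := by
    intro d x hx
    refine hirr.eq_zero_of_lie_e_eq_zero hg (d := n + j + d) ha
      (Submodule.sum_mem _ fun i _ => lie_f_mem_layer (hmem _) _)
      (Submodule.sum_mem _ fun i hi => ?_) fun l => ?_
    · have hi : i ≤ n := Nat.lt_succ_iff.1 (Finset.mem_range.1 hi)
      have := hg.lie_mem (f k) (i + j) _ _
        (map_smul_mem_of_mem_degreeSpan hg hψ (hc.mem_degreeSpan i hi) hx)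
      convert this using 2
      ring
    -- As `e(l)` kills the lowest layer, only `[e(l), f(i + j)] = h(i + j + l)` contributes, turning
    -- the sum into the recurrence for `p`.
    · have h1 : ∀ i ∈ Finset.range (n + 1),
          ⁅loop (e k) l, ⁅loop (f k) (i + j), ψ (c i • x)⁆⁆ =
            (-2 : k) • ψ ((c i * p (i + (l + j))) • x) := fun i _ => by
        rw [lie_e_lie_f, hE _ _ (hmem _), lie_zero, add_zero, ← hψ, ← mul_smul, mul_comm (c i),
          add_left_comm]
      rw [lie_sum, Finset.sum_congr rfl h1, ← Finset.smul_sum, ← map_sum, ← Finset.sum_smul,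
        hc.sum_eq_zero, zero_smul, map_zero, smul_zero]
  let D : X →ₗ[k] V :=
    { toFun := fun x => ∑ i ∈ Finset.range (n + 1), ⁅loop (f k) (i + j), ψ (c i • x)⁆
      map_add' := fun x y => by simp [Finset.sum_add_distrib]
      map_smul' := fun b x => by simp [Finset.smul_sum, smul_algebra_smul_comm] }
  have hle : layer V a ≤ (LinearMap.ker D).map ψ := by
    refine (hg.layer_le_iSup htop a).trans (iSup_le fun d => ?_)
    rintro v ⟨hv, hvd⟩
    rw [← hrange] at hv
    obtain ⟨y, rfl⟩ := hv
    exact ⟨y, hhom d y hvd, rfl⟩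
  obtain ⟨y, hy, hyx⟩ := hle (hmem x)
  -- `x` and `y` differ by an element of the kernel of `ψ`; its image `0` is homogeneous, so `hhom`
  -- applies to the difference too.
  have h0 : D (x - y) = 0 := hhom 0 _ (by rw [map_sub, hyx, sub_self]; exact zero_mem _)
  rw [map_sub, LinearMap.mem_ker.1 hy, sub_zero] at h0
  exact h0

/-- On the lowest layer the operators `f(0), …, f(n - 1)` suffice. -/
lemma lie_f_mem_iSup_map (hg : IsGrading 𝒱) (hirr : IsGradedIrreducible 𝒱)
    (htop : ⨆ a : k, layer V a = ⊤) (hc : HasRecurrence k p n c) {a : k}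
    (hψ : ∀ j x, (-2 : k) • ψ (p j • x) = ⁅loop (h k) j, ψ x⁆)
    (hrange : LinearMap.range ψ = layer V a) (ha : layer V a ≠ ⊥)
    (hE : ∀ j, ∀ v ∈ layer V a, ⁅loop (e k) j, v⁆ = 0) (j : ℤ) :
    ∀ v ∈ layer V a, ⁅loop (f k) j, v⁆ ∈
      ⨆ i : Fin n, (layer V a).map (LieModule.toEnd k (Loop k) V (loop (f k) i)) := by
  have hmem : ∀ x, ψ x ∈ layer V a := fun x => hrange ▸ ⟨x, rfl⟩
  have hsum := sum_lie_f_eq_zero hg hirr htop hc hψ hrange ha hE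
  obtain ⟨d, hd⟩ := hc.isUnit_zero.exists_right_inv
  induction j using int_window_induction n with
  | hbase i hi =>
    intro v hv
    exact Submodule.mem_iSup_of_mem (⟨i, hi⟩ : Fin n) ⟨v, hv, rfl⟩
  | hup j hj =>
    intro v hv
    rw [← hrange] at hv
    obtain ⟨x, rfl⟩ := hv
    have h1 := hsum j x
    rw [Finset.sum_range_succ, hc.top_eq_one, one_smul] at h1
    rw [eq_neg_of_add_eq_zero_right h1]
    exact neg_mem (sum_mem fun i hi => hj i (Finset.mem_range.1 hi) _ (hmem _))
  | hdown j hj =>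
    intro v hv
    rw [← hrange] at hv
    obtain ⟨x, rfl⟩ := hv
    -- Replacing `x` by `d • x` makes the term with `c 0` equal to `f(j)` applied to `ψ x`.
    have h1 := hsum j (d • x)
    rw [Finset.sum_range_succ', Nat.cast_zero, zero_add, ← mul_smul (c 0), hd, one_smul] at h1
    rw [eq_neg_of_add_eq_zero_right h1]
    exact neg_mem (sum_mem fun i hi => hj i (Finset.mem_range.1 hi) _ (hmem _))

/-- The homogeneous components of the lowest layer have finite dimension. -/
lemma finiteDimensional_lowest_component (hg : IsGrading 𝒱) (hirr : IsGradedIrreducible 𝒱)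
    (htop : ⨆ a : k, layer V a = ⊤) (hc : HasRecurrence k p n c)
    (hp : Algebra.adjoin k (Set.range p) = ⊤) {a : k}
    (hψ : ∀ j x, (-2 : k) • ψ (p j • x) = ⁅loop (h k) j, ψ x⁆)
    (hrange : LinearMap.range ψ = layer V a) (ha : layer V a ≠ ⊥)
    (hE : ∀ j, ∀ v ∈ layer V a, ⁅loop (e k) j, v⁆ = 0) (j : ℤ) :
    FiniteDimensional k (layer V a ⊓ 𝒱 j : Submodule k V) := by
  have hmem : ∀ x, ψ x ∈ layer V a := fun x => hrange ▸ ⟨x, rfl⟩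
  obtain ⟨d, q, ⟨hqa, hqd⟩, hq0⟩ := hg.exists_mem_layer_ne_zero htop ha
  rw [← hrange] at hqa
  obtain ⟨x, rfl⟩ := hqa
  let π : S →ₗ[k] V := ψ ∘ₗ (LinearMap.toSpanSingleton S X x).restrictScalars k
  have hπ : ∀ s, π s = ψ (s • x) := fun s => rfl
  have hdeg : ∀ m, ∀ s ∈ degreeSpan (k := k) p m, π s ∈ 𝒱 (m + d) := fun m s hs =>
    map_smul_mem_of_mem_degreeSpan hg hψ hs hqd
  have hgen : ∀ m, ∀ s ∈ degreeSpan (k := k) p m, π s ≠ 0 →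
      ∀ v ∈ layer V a, ∃ t, π (t * s) = v := by
    intro m s hs hs0 v hv
    -- The space of all `π (t * s)` is `h`-stable and contains the homogeneous vector `π s`, so its
    -- words fill `V`; comparing stage zero with the layer shows that it is the whole layer.
    let Y : Submodule k V := LinearMap.range (π ∘ₗ LinearMap.mulRight k s)
    have hYa : Y ≤ layer V a := by
      rintro _ ⟨t, rfl⟩
      exact hmem _
    have hY : ⨆ r, fStage Y r = ⊤ := by
      refine hirr.iSup_fStage_eq_top hg ?_ (fun j x hx => hE j x (hYa hx))
        (⟨1, by simp⟩ : π s ∈ Y) (hdeg m s hs) hs0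
      rintro i _ ⟨t, rfl⟩
      refine ⟨(-2 : k) • (p i * t), ?_⟩
      rw [map_smul]
      refine Eq.trans ?_ (hψ i ((t * s) • x))
      simp only [LinearMap.comp_apply, LinearMap.mulRight_apply, hπ, mul_smul]
    have := layer_le_fStage hYa hY 0
    rw [Nat.cast_zero, add_zero] at this
    exact this hv
  let I : Ideal S :=
    { carrier := {s | π s = 0}
      zero_mem' := map_zero π
      add_mem' := fun {s t} hs ht => by
        change π (s + t) = 0
        rw [map_add, hs, ht, add_zero]
      smul_mem' := fun t s hs => by
        change π (t * s) = 0
        rw [hπ, mul_smul]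
        exact map_smul_eq_zero hp hψ t hs }
  have hI : I ≠ ⊤ := fun hI => hq0 <| by
    have : π 1 = 0 := (Ideal.eq_top_iff_one I).1 hI
    rwa [hπ, one_smul] at this
  obtain ⟨M, hM, hIM⟩ := Ideal.exists_le_maximal I hI
  -- `M` need not be homogeneous; only its homogeneous elements are shown to act by zero.
  have hker : ∀ m, ∀ s ∈ degreeSpan (k := k) p m, s ∈ M → π s = 0 := by
    intro m s hs hsM
    by_contra hs0
    obtain ⟨t, ht⟩ := hgen m s hs hs0 _ (hmem x)
    have h1 : t * s - 1 ∈ I := by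
      change π (t * s - 1) = 0
      rw [map_sub, ht, hπ, one_smul, sub_self]
    refine hM.ne_top ((Ideal.eq_top_iff_one M).2 ?_)
    have := M.sub_mem (M.mul_mem_left t hsM) (hIM h1)
    rwa [sub_sub_cancel] at this
  have : Algebra.FiniteType k S := hc.finiteType hp
  let _ : Field (S ⧸ M) := Ideal.Quotient.field M
  have hfin : Module.Finite k (S ⧸ M) :=
    finite_of_finite_type_of_isJacobsonRing k (S ⧸ M)
  -- The generating vector has degree `d`, hence the shift. By `hker`, `π` on elements of one degree
  -- factors through their residues modulo `M`.
  let B : ℤ → Submodule k V := fun j => (degreeSpan (k := k) p (j - d)).map π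
  have hBfin : Module.Finite k (B j) := by
    have := finite_range_of_ker_le
      ((Ideal.Quotient.mkₐ k M).toLinearMap ∘ₗ (degreeSpan (k := k) p (j - d)).subtype)
      (π ∘ₗ (degreeSpan (k := k) p (j - d)).subtype) fun s hs =>
        hker _ s.1 s.2 (Ideal.Quotient.eq_zero_iff_mem.1 hs)
    rwa [LinearMap.range_comp, Submodule.range_subtype] at this
  have hle : layer V a ⊓ 𝒱 j ≤ B j := by
    have h1 := inf_iSup_le_of_iSupIndep hg.isInternal.submodule_iSupIndep (A := B) (fun i => by
      rintro _ ⟨s, hs, rfl⟩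
      simpa using hdeg _ s hs) j
    have h2 : layer V a ≤ ⨆ i, B i := by
      intro v hv
      obtain ⟨t, rfl⟩ := hgen 0 1 (one_mem_degreeSpan p) (by rwa [hπ, one_smul]) v hv
      have ht : t * 1 ∈ ⨆ m, degreeSpan (k := k) p m := by
        rw [iSup_degreeSpan_eq_top hp]; trivial
      have h3 : ⨆ m, degreeSpan (k := k) p m ≤ (⨆ i, B i).comap π :=
        iSup_le fun m s hs => Submodule.mem_iSup_of_mem (m + d) ⟨s, by simpa using hs, rfl⟩
      exact h3 ht
    exact fun v hv => h1 ⟨hv.2, h2 hv.1⟩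
  exact Submodule.finiteDimensional_of_le hle

/-- The homogeneous components of all layers above the lowest one have finite dimension. -/
lemma finiteDimensional_layer_inf (hg : IsGrading 𝒱) (hirr : IsGradedIrreducible 𝒱)
    (htop : ⨆ a : k, layer V a = ⊤) (hc : HasRecurrence k p n c)
    (hp : Algebra.adjoin k (Set.range p) = ⊤) {a : k}
    (hψ : ∀ j x, (-2 : k) • ψ (p j • x) = ⁅loop (h k) j, ψ x⁆)
    (hrange : LinearMap.range ψ = layer V a) (ha : layer V a ≠ ⊥)
    (hE : ∀ j, ∀ v ∈ layer V a, ⁅loop (e k) j, v⁆ = 0)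
    (hstage : ⨆ r, fStage (layer V a) r = ⊤) (r : ℕ) (j : ℤ) :
    FiniteDimensional k (layer V (a + r) ⊓ 𝒱 j : Submodule k V) := by
  have hst : ∀ r : ℕ, layer V (a + r) = fStage (layer V a) r := fun r =>
    le_antisymm (layer_le_fStage le_rfl hstage r) (fStage_le_layer le_rfl r)
  induction r generalizing j with
  | zero =>
    rw [Nat.cast_zero, add_zero]
    exact finiteDimensional_lowest_component hg hirr htop hc hp hψ hrange ha hE j
  | succ r ih =>
    -- Only finitely many `i` occur, so `B j` is finite-dimensional by induction; being of degree
    -- `j` and jointly spanning the layer, these spaces are its components.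
    let B : ℤ → Submodule k V := fun j => ⨆ i : Fin n, (layer V (a + r) ⊓ 𝒱 (j - (i : ℕ))).map
      (LieModule.toEnd k (Loop k) V (loop (f k) (i : ℕ)))
    have hB : ∀ j, B j ≤ 𝒱 j := fun j => iSup_le fun i => by
      rintro _ ⟨v, hv, rfl⟩
      simpa using hg.lie_mem (f k) (i : ℕ) _ v hv.2
    have h1 := inf_iSup_le_of_iSupIndep hg.isInternal.submodule_iSupIndep hB j
    have h2 : layer V (a + (r + 1 : ℕ)) ≤ ⨆ j, B j := by
      rw [hst]
      refine (fStage_succ_le_iSup_map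
        (lie_f_mem_iSup_map hg hirr htop hc hψ hrange ha hE) r).trans (iSup_le fun i => ?_)
      rw [← hst, Submodule.map_le_iff_le_comap]
      refine (hg.layer_le_iSup htop _).trans (iSup_le fun d v hv => ?_)
      refine Submodule.mem_iSup_of_mem (d + (i : ℕ)) (Submodule.mem_iSup_of_mem i ⟨v, ?_, rfl⟩)
      simpa using hv
    have hfin : FiniteDimensional k (B j) := Submodule.finiteDimensional_iSup _
    exact Submodule.finiteDimensional_of_le (S₂ := B j) fun v hv => h1 ⟨hv.2, h2 hv.1⟩

end LowestLayer

end ImaginaryVerma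

/-! ### Reduction to the lowest nonzero layer of the subquotient. -/

open ImaginaryVerma in
theorem mainTheorem7 (k : Type*) [Field k] [CharZero k] [IsAlgClosed k]
    (Q : Type*) [AddCommGroup Q] [Module k Q] [LieRingModule (ImaginaryVerma.Loop k) Q]
    [LieModule k (ImaginaryVerma.Loop k) Q] (𝒬 : ℤ → Submodule k Q)
    (h_grading : ImaginaryVerma.IsGrading 𝒬)
    (h_irreducible : ImaginaryVerma.IsGradedIrreducible 𝒬)
    (h_subquotient : ImaginaryVerma.IsSubquotient (ImaginaryVerma.degMBar k) 𝒬)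
    (a : k) (j : ℤ) :
    FiniteDimensional k (ImaginaryVerma.component 𝒬 a j) := by
  classical
  obtain ⟨N, P, -, -, -, φ, -⟩ := h_subquotient
  let ρ : N →ₗ⁅k, Loop k⁆ Q :=
    φ.symm.toLieModuleHom.comp (LieSubmodule.Quotient.mk' (P.comap N.incl))
  have hρ : Function.Surjective ρ :=
    φ.symm.surjective.comp (LieSubmodule.Quotient.surjective_mk' _)
  have hle := range_laurentToQuotient_le_layer ρ
  have htop := iSup_range_laurentToQuotient ρ hρ
  have hlayers : ∀ b, layer Q b ≤ ⨆ (n : ℕ) (_ : (n : k) = b),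
      LinearMap.range (laurentToQuotient ρ n) :=
    layer_le_iSup_of_iSup_eq_top (c := fun n : ℕ => (n : k)) hle htop
  have hrange : ∀ n, LinearMap.range (laurentToQuotient ρ n) = layer Q (n : k) := fun n =>
    le_antisymm (hle n) ((hlayers n).trans (iSup₂_le fun m hm => by rw [Nat.cast_injective hm]))
  have hnat : ∀ b, layer Q b ≠ ⊥ → ∃ n : ℕ, (n : k) = b := fun b hb => by
    by_contra! hcon
    exact hb (eq_bot_iff.2 ((hlayers b).trans (iSup₂_le fun n hn => absurd hn (hcon n))))
  have htop' : ⨆ b : k, layer Q b = ⊤ := by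
    rw [eq_top_iff, ← htop]
    exact iSup_le fun n => (hle n).trans (le_iSup (fun b : k => layer Q b) n)
  have hex : ∃ n : ℕ, layer Q (n : k) ≠ ⊥ := by
    by_contra! hcon
    have := h_irreducible.1
    refine bot_ne_top (α := Submodule k Q) ?_
    rw [← htop]
    simp only [hrange, hcon, iSup_bot]
  obtain ⟨n, hn0, hmin⟩ : ∃ n : ℕ, layer Q (n : k) ≠ ⊥ ∧ ∀ m < n, layer Q (m : k) = ⊥ :=
    ⟨Nat.find hex, Nat.find_spec hex, fun m hm => not_not.1 (Nat.find_min hex hm)⟩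
  -- The layer of index `n - 1` vanishes: a nonzero layer has a natural index, and that index would
  -- be smaller than the minimal `n`.
  have hE : ∀ j, ∀ v ∈ layer Q (n : k), ⁅loop (e k) j, v⁆ = 0 := by
    intro j v hv
    have h1 := lie_e_mem_layer hv j
    by_cases h2 : layer Q ((n : k) - 1) = ⊥
    · rwa [h2, Submodule.mem_bot] at h1
    · obtain ⟨m, hm⟩ := hnat _ h2
      have h3 : m + 1 = n := by
        have : ((m + 1 : ℕ) : k) = n := by push_cast; linear_combination hm
        exact_mod_cast this
      rw [← hm] at h2
      exact absurd (hmin m (by omega)) h2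
  obtain ⟨c, hc⟩ := exists_hasRecurrence (k := k) (laurentVar k (n := n))
  have hstage : ⨆ r, fStage (layer Q (n : k)) r = ⊤ := by
    obtain ⟨d, q, hq, hq0⟩ := h_grading.exists_mem_layer_ne_zero htop' hn0
    exact h_irreducible.iSup_fStage_eq_top h_grading (fun j x hx => lie_h_mem_layer hx j) hE hq.1
      hq.2 hq0
  -- Words in the `f(j)` on the lowest layer reach only the indices `n + r`, so every other layer is
  -- zero.
  by_cases har : ∃ r : ℕ, (n : k) + r = a
  · obtain ⟨r, rfl⟩ := har
    exact finiteDimensional_layer_inf (S := powerSumAlgebra k (laurentVar k (n := n)))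
      (X := laurentPreimage N n) (ψ := laurentToQuotient ρ n) h_grading h_irreducible htop' hc
      (adjoin_powerSum' _) (laurentToQuotient_powerSum_smul ρ (n := n)) (hrange n) hn0 hE
      hstage r j
  · push Not at har
    rw [component, layer_eq_bot_of_ne le_rfl hstage har, bot_inf_eq]
    infer_instance

end
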